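/- Let $\mathbb K$ be an algebraically closed field of characteristic zero, let $\omega\in\mathbb R^N$ have rationally independent coordinates, and write $\mathbb K[x^*,y]=\mathbb K[x_1^{\pm1},\dots,x_N^{\pm1},y_1,\dots,y_M]$. An ideal $\mathcal I\subset\mathbb K[x^*,y]$ is \emph{$N$-admissible} if the projection $(x,y)\mapsto x$ from the set of common zeroes of $\mathcal I\cap\mathbb K[x,y]$ in $\mathbb K^{N+M}$ to $\mathbb K^N$ is dominant with finite generic fibre. For $\eta\in(\mathbb R\cup\{\infty\})^M$ (with $\infty\cdot 0=0$ and $\infty\cdot a=\infty$ for $a\ne0$) put $\Lambda(\eta)=\{i\mid\eta_i\neq\infty\}$. The $(\omega,\eta)$-order of $f=\sum a_{\alpha,\beta}x^\alpha y^\beta$ is $\min_{a_{\alpha,\beta}\ne0}(\omega\cdot\alpha+\eta\cdot\beta)$; its initial part $\mathrm{In}_{\omega,\eta}f$ is the sum of the terms attaining a finite minimum, and $0$ if the order is $\infty$; $\mathrm{In}_{\omega,\eta}\mathcal I$ is the ideal generated by all $\mathrm{In}_{\omega,\eta}f$, $f\in\mathcal I$, and all $y_i$, $i\notin\Lambda(\eta)$.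 The tropical variety $\tau(\mathcal I)$ is the set of $(\omega,\eta)$ such that $\mathrm{In}_{\omega,\eta}\mathcal I$ contains no monomial $a x^\alpha y^\beta$, $a\neq0$, involving only the $y_i$ with $i\in\Lambda(\eta)$. An \emph{$\omega$-set} is a triple $D=\{\eta,\Gamma,c\}$ with $\eta\in(\mathbb R\cup\{\infty\})^M$, $\Gamma$ an $M\times N$ matrix over $\mathbb Q\cup\{\infty\}$ and $c\in\mathbb K^M$, such that $\omega\cdot\Gamma_{i,*}=\eta_i$ and $c_i\ne0$ for $i\in\Lambda(\eta)$, while all entries of $\Gamma_{i,*}$ are $\infty$ and $c_i=0$ for $i\notin\Lambda(\eta)$. It is a \emph{starting $\omega$-set} for $\mathcal I$ if $(\omega,\eta)\in\tau(\mathcal I)$ and $f(\underline 1,c)=0$ for all $f\in\mathrm{In}_{\omega,\eta}\mathcal I$. Let $\mathbf d\Gamma$ be the least common multiple of the denominators of the finite entries of $\Gamma$, and let $\mathcal I_D\subset\mathbb K[x^*,y]$ be the ideal generated by the polynomials obtained from the elements of $\mathcal I$ by substituting $x_j\mapsto x_j^{\mathbf d\Gamma}$ and $y_i\mapsto y_i+c_ix^{\mathbf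 d\Gamma\,\Gamma_{i,*}}$ (where $c_ix^{\mathbf d\Gamma\,\Gamma_{i,*}}:=0$ if $i\notin\Lambda(\eta)$). For $k\in\mathbb Z_{\ge0}\cup\{\infty\}$, a sequence $\{D^{(i)}\}_{i=0}^{k}$ of $\omega$-sets $D^{(i)}=\{\eta^{(i)},\Gamma^{(i)},c^{(i)}\}$ is an \emph{$\omega$-sequence} for $\mathcal I$ if, with $\mathcal I^{(0)}=\mathcal I$ and $\mathcal I^{(i)}=\mathcal I^{(i-1)}_{D^{(i-1)}}$, each $D^{(i)}$ is a starting $\omega$-set for $\mathcal I^{(i)}$ and, for all $i\ge1$, $\eta^{(i)}_j>\mathbf d\Gamma^{(i-1)}\eta^{(i-1)}_j$ for every $j\in\Lambda(\eta^{(i)})$. Let $\mathcal I\subset\mathbb K[x^*,y]$ be an $N$-admissible ideal. (1) For every starting $\omega$-set $D=\{\eta,\Gamma,c\}$ for $\mathcal I$, the ideal $\mathcal I_D$ is $N$-admissible and there is a starting $\omega$-set $D'=\{\eta',\Gamma',c'\}$ for $\mathcal I_D$ with $\eta'_j>\mathbf d\Gamma\,\eta_j$ for every $j\in\Lambda(\eta')$.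 (2) For every finite $\omega$-sequence $\{D^{(i)}\}_{i=0}^{k}$ for $\mathcal I$ and every $k'\in\{k+1,k+2,\dots\}\cup\{\infty\}$ there are $D^{(i)}$, $k<i\le k'$, such that $\{D^{(i)}\}_{i=0}^{k'}$ is an $\omega$-sequence for $\mathcal I$. In particular, every finite $\omega$-sequence for $\mathcal I$ extends to an infinite one. -/

import Mathlib

namespace NewtonPuiseux

noncomputable section

/-- The Laurent polynomial ring `K[x*] = K[x₁, x₁⁻¹, …, x_N, x_N⁻¹]`:
`AddMonoidAlgebra.single α a` is the term `a x^α`, `α ∈ ℤ^N`. -/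
abbrev Laurent (K : Type*) [Field K] (N : ℕ) : Type _ :=
  AddMonoidAlgebra K (Fin N → ℤ)

/-- The ring `K[x*, y] = K[x*][y₁, …, y_M]`. -/
abbrev LaurentPoly (K : Type*) [Field K] (N M : ℕ) : Type _ :=
  MvPolynomial (Fin M) (Laurent K N)

section Admissible

variable {K : Type*} [Field K] {N M : ℕ}

/-- The inclusion of `K[x, y]` in `K[x*, y]`; the variables `Sum.inl j` are the `x_j` and the
variables `Sum.inr i` are the `y_i`. -/
def inclusion (K : Type*) [Field K] (N M : ℕ) :
    MvPolynomial (Fin N ⊕ Fin M) K →+* LaurentPoly K N M :=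
  MvPolynomial.eval₂Hom (MvPolynomial.C.comp (algebraMap K (Laurent K N)))
    (Sum.elim (fun j => MvPolynomial.C (AddMonoidAlgebra.single (Pi.single j 1) 1))
      MvPolynomial.X)

/-- The set of common zeroes in `K^(N+M)` of an ideal of `K[x, y]`, as a set of pairs `(x, y)`. -/
def commonZeroes (J : Ideal (MvPolynomial (Fin N ⊕ Fin M) K)) :
    Set ((Fin N → K) × (Fin M → K)) :=
  {p | ∀ f ∈ J, MvPolynomial.eval (Sum.elim p.1 p.2) f = 0}

/-- An ideal of `K[x, y]` is `N`-admissible when the projection of its set of common zeroes to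
`K^N` is dominant (the image is Zariski dense) and of finite generic fibre (the fibres over a
nonempty Zariski open subset of `K^N` are finite). -/
def IsNAdmissiblePoly (J : Ideal (MvPolynomial (Fin N ⊕ Fin M) K)) : Prop :=
  (∀ p : MvPolynomial (Fin N) K,
      (∀ x ∈ Prod.fst '' commonZeroes J, MvPolynomial.eval x p = 0) → p = 0) ∧
  (∃ q : MvPolynomial (Fin N) K, q ≠ 0 ∧
      ∀ x : Fin N → K, MvPolynomial.eval x q ≠ 0 → {y | (x, y) ∈ commonZeroes J}.Finite)

/-- An ideal of `K[x*, y]` is `N`-admissible when its contraction to `K[x, y]` is. -/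
def IsNAdmissible (I : Ideal (LaurentPoly K N M)) : Prop :=
  IsNAdmissiblePoly (I.comap (inclusion K N M))

end Admissible

section Initial

variable {K : Type*} [Field K] {N M : ℕ}

/-- The weight `ω · α + η · β` of the monomial `x^α y^β`. In `WithTop ℝ` one has `0 * ⊤ = 0` and
`a * ⊤ = ⊤` for every `a ≠ 0`. -/
def weight (ω : Fin N → ℝ) (η : Fin M → WithTop ℝ) (α : Fin N → ℤ) (β : Fin M →₀ ℕ) :
    WithTop ℝ :=
  ((∑ j, ω j * (α j : ℝ) : ℝ) : WithTop ℝ) + ∑ i, ((β i : ℝ) : WithTop ℝ) * η i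

/-- The `(ω, η)`-order: the least weight of a term of `f` (`∞` if `f = 0`). -/
def polyOrder (ω : Fin N → ℝ) (η : Fin M → WithTop ℝ) (f : LaurentPoly K N M) : WithTop ℝ :=
  f.support.inf fun β => (f.coeff β).coeff.support.inf fun α => weight ω η α β

open Classical in
/-- The `(ω, η)`-initial part: the sum of the terms of least weight, and `0` if the
`(ω, η)`-order is `∞`. -/
def initialPart (ω : Fin N → ℝ) (η : Fin M → WithTop ℝ) (f : LaurentPoly K N M) :
    LaurentPoly K N M :=
  if polyOrder ω η f = ⊤ then 0
  else ∑ β ∈ f.support, ∑ α ∈ (f.coeff β).coeff.support with weight ω η α β = polyOrder ω η f,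
    MvPolynomial.monomial β (AddMonoidAlgebra.single α ((f.coeff β).coeff α))

/-- The `(ω, η)`-initial ideal: generated by the initial parts of the elements of `I` and by the
variables `y_i` with `η_i = ∞`. -/
def initialIdeal (ω : Fin N → ℝ) (η : Fin M → WithTop ℝ) (I : Ideal (LaurentPoly K N M)) :
    Ideal (LaurentPoly K N M) :=
  Ideal.span (initialPart ω η '' (I : Set (LaurentPoly K N M)) ∪
    MvPolynomial.X '' {i : Fin M | η i = ⊤})

/-- The tropical variety of `I`: the `(ω, η)` for which the initial ideal contains no monomial
`a x^α y^β`, `a ≠ 0`, in the variables `x` and the `y_i` with `η_i ≠ ∞`. -/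
def tropicalVariety (I : Ideal (LaurentPoly K N M)) :
    Set ((Fin N → ℝ) × (Fin M → WithTop ℝ)) :=
  {p | ∀ (a : K) (α : Fin N → ℤ) (β : Fin M →₀ ℕ), a ≠ 0 → (∀ i, p.2 i = ⊤ → β i = 0) →
    MvPolynomial.monomial β (AddMonoidAlgebra.single α a) ∉ initialIdeal p.1 p.2 I}

/-- The value `f(1, c)` of `f ∈ K[x*, y]` at `x = (1, …, 1)`, `y = c`. -/
def evalOne (c : Fin M → K) : LaurentPoly K N M →+* K :=
  MvPolynomial.eval₂Hom
    (AddMonoidAlgebra.lift K K (Fin N → ℤ) (1 : Multiplicative (Fin N → ℤ) →* K)).toRingHom c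

end Initial

/-- An `ω`-set `{η, Γ, c}`. The equation `ω · Γᵀ = η` is required in the rows with `η_i ≠ ∞`; in
the other rows it is a consequence of `Γ_{i,*} = ∞` when `N ≥ 1` and all `ω_j` are nonzero. -/
structure OmegaSet (K : Type*) [Field K] {N : ℕ} (M : ℕ) (ω : Fin N → ℝ) where
  η : Fin M → WithTop ℝ
  Γ : Matrix (Fin M) (Fin N) (WithTop ℚ)
  c : Fin M → K
  dot_eq : ∀ i, η i ≠ ⊤ →
    ∑ j, (ω j : WithTop ℝ) * (Γ i j).map (fun q : ℚ => (q : ℝ)) = η i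
  row_eq_top : ∀ i, η i = ⊤ → ∀ j, Γ i j = ⊤
  c_ne_zero : ∀ i, η i ≠ ⊤ → c i ≠ 0
  c_eq_zero : ∀ i, η i = ⊤ → c i = 0

/-- `dΓ`: the least common multiple of the denominators of the finite entries of `Γ`. -/
def denom {N M : ℕ} (Γ : Matrix (Fin M) (Fin N) (WithTop ℚ)) : ℕ :=
  Finset.univ.lcm fun p : Fin M × Fin N => ((Γ p.1 p.2).untopD 0).den

/-- The row `dΓ · Γ_{i,*}`, which is integral; the entries equal to `∞` are replaced by `0`. -/
def scaledRow {N M : ℕ} (Γ : Matrix (Fin M) (Fin N) (WithTop ℚ)) (i : Fin M) : Fin N → ℤ :=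
  fun j => ((denom Γ : ℚ) * (Γ i j).untopD 0).num

theorem denom_pos {N M : ℕ} (Γ : Matrix (Fin M) (Fin N) (WithTop ℚ)) : 0 < denom Γ := by
  refine Nat.pos_of_ne_zero fun h => ?_
  obtain ⟨p, -, hp⟩ := Finset.lcm_eq_zero_iff.1 h
  exact Rat.den_nz _ hp

theorem scaledRow_cast {N M : ℕ} (Γ : Matrix (Fin M) (Fin N) (WithTop ℚ)) (i : Fin M)
    (j : Fin N) : (scaledRow Γ i j : ℚ) = (denom Γ : ℚ) * (Γ i j).untopD 0 := by
  obtain ⟨k, hk⟩ : ((Γ i j).untopD 0).den ∣ denom Γ :=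
    Finset.dvd_lcm (f := fun p : Fin M × Fin N => ((Γ p.1 p.2).untopD 0).den)
      (Finset.mem_univ (i, j))
  have h : (denom Γ : ℚ) * (Γ i j).untopD 0 = ((k * ((Γ i j).untopD 0).num : ℤ) : ℚ) := by
    rw [hk]
    push_cast
    rw [mul_comm (((Γ i j).untopD 0).den : ℚ), mul_assoc, mul_comm _ ((Γ i j).untopD 0),
      Rat.mul_den_eq_num]
  rw [scaledRow, h, Rat.num_intCast]

/-- `dΓ` is the least positive integer `k` such that `k Γ` has all its entries in `ℤ ∪ {∞}`. -/
theorem denom_le {N M : ℕ} (Γ : Matrix (Fin M) (Fin N) (WithTop ℚ)) (k : ℕ) (hk : 0 < k)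
    (h : ∀ i j, ∃ z : ℤ, (k : ℚ) * (Γ i j).untopD 0 = z) : denom Γ ≤ k := by
  refine Nat.le_of_dvd hk (Finset.lcm_dvd fun p _ => ?_)
  obtain ⟨z, hz⟩ := h p.1 p.2
  have hk' : (k : ℚ) ≠ 0 := by exact_mod_cast hk.ne'
  have : (Γ p.1 p.2).untopD 0 = Rat.divInt z k := by
    rw [Rat.divInt_eq_div, eq_div_iff (by exact_mod_cast hk.ne'), mul_comm]
    exact_mod_cast hz
  rw [this]
  exact_mod_cast Rat.den_dvd z k

section Sequences

variable {K : Type*} [Field K] {N M : ℕ} {ω : Fin N → ℝ}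

/-- `D` is a starting `ω`-set for `I`. -/
def IsStarting (I : Ideal (LaurentPoly K N M)) (D : OmegaSet K M ω) : Prop :=
  (ω, D.η) ∈ tropicalVariety I ∧ ∀ f ∈ initialIdeal ω D.η I, evalOne D.c f = 0

/-- The substitution `f(x, y) ↦ f(x^{dΓ}, y + 𝔐_D(x^{dΓ}))`, where `𝔐_D(x^{dΓ})` has the entries
`c_i x^{dΓ Γ_{i,*}}` (so `0` where `η_i = ∞`). -/
def substitution (D : OmegaSet K M ω) : LaurentPoly K N M →+* LaurentPoly K N M :=
  MvPolynomial.eval₂Hom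
    (MvPolynomial.C.comp (AddMonoidAlgebra.mapDomainRingHom K
      (nsmulAddMonoidHom (α := Fin N → ℤ) (denom D.Γ))))
    (fun i => MvPolynomial.X i +
      MvPolynomial.C (AddMonoidAlgebra.single (scaledRow D.Γ i) (D.c i)))

/-- The transformed ideal `I_D`, generated by the `f(x^{dΓ}, y + 𝔐_D(x^{dΓ}))`, `f ∈ I`. -/
def transform (I : Ideal (LaurentPoly K N M)) (D : OmegaSet K M ω) :
    Ideal (LaurentPoly K N M) :=
  Ideal.span (substitution D '' (I : Set (LaurentPoly K N M)))

/-- `η'_i > dΓ · η_i` for every `i` with `η'_i ≠ ∞`. -/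
def Exceeds (D D' : OmegaSet K M ω) : Prop :=
  ∀ i, D'.η i ≠ ⊤ → ((denom D.Γ : ℝ) : WithTop ℝ) * D.η i < D'.η i

/-- The ideals `I⁽⁰⁾ = I`, `I⁽ⁱ⁺¹⁾ = (I⁽ⁱ⁾)_{D⁽ⁱ⁾}`. -/
def idealSeq (I : Ideal (LaurentPoly K N M)) (S : ℕ → OmegaSet K M ω) :
    ℕ → Ideal (LaurentPoly K N M)
  | 0 => I
  | i + 1 => transform (idealSeq I S i) (S i)

/-- The terms `S 0, …, S L` (all the terms if `L = ∞`) form an `ω`-sequence for `I`. The terms of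
`S` beyond the index `L` play no role. -/
def IsOmegaSequence (I : Ideal (LaurentPoly K N M)) (L : ℕ∞) (S : ℕ → OmegaSet K M ω) : Prop :=
  (∀ i : ℕ, (i : ℕ∞) ≤ L → IsStarting (idealSeq I S i) (S i)) ∧
  (∀ i : ℕ, ((i + 1 : ℕ) : ℕ∞) ≤ L → Exceeds (S i) (S (i + 1)))

end Sequences

end

end NewtonPuiseux

/-! Write `d` for `denom D.Γ` and `r_i` for `scaledRow D.Γ i`, so that `ω · r_i = d η_i` in the
finite rows. The heart of the proof is to turn a starting `ω`-set `D` into an actual zero of `I`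
over a valued field, with leading terms prescribed by `D`; the next `ω`-set is then read off from
what remains after subtracting these leading terms.

Put `t_i = x^{-r_i} y_i` and let `A` be spanned by the monomials `x^δ` with `ω · δ ≥ 0`. The residue
map `A[t] → K` kills every `x^δ` with `δ ≠ 0` and sends `t_i` to `c_i`. An element of `A[t]` that
lies in the ideal generated by the `f(x^d, y)`, `f ∈ I`, and the `y_i` with `η_i = ∞` has residue
`0` (`IsScaling.residue_eq_zero`): split by exponents modulo `d`, its relevant terms come from
elements of `I`, whose initial parts vanish at `(1, c)`. Hence some prime contains this ideal and
avoids every monomial times an element of nonzero residue. In the algebraic closure `L` of the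
fraction field of the quotient, a valuation ring contains the image of `A[t]` and has the image of
the kernel of the residue map among its nonunits (`IsScaling.exists_valuationSubring`).

In `L`, the point `z_i = y_i - c_i x^{r_i}` is a zero of the transformed ideal, and `K[x*]` embeds
in `L`; therefore the transformed ideal meets `K[x*]` in `0`. Finite generic fibres make every `y_i`
algebraic modulo `I` (`IsNAdmissible.isAlgebraicMod`, through Chevalley's theorem), and this
survives the substitution; together with the trivial intersection it gives admissibility back
(`IsAlgebraicMod.isNAdmissible`). Since `z_i` is algebraic over `K[x*]`, a nonzero `z_i` has the
value of some `x^{γ/n}` and, `K` being algebraically closed, a leading coefficient in `K`. These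
data form `D'` (`IsCentred.exists_omegaSet`), and polynomials vanishing at `z` have initial parts
vanishing at `(1, c')`. The increase of `η` holds because `z_i x^{-r_i} = t_i - c_i` has residue
`0`. Iterating this step proves the second claim. -/

namespace NewtonPuiseux

noncomputable section

/-! ### Admissibility as algebraicity of the `y_i` over `K[x*]`. -/

section Admissibility

open MvPolynomial

/-- Chevalley's theorem for an injective homomorphism of domains: the image on spectra contains a
nonempty basic open set. -/
theorem exists_ne_zero_forall_exists_comap_eq {A B : Type*} [CommRing A] [IsDomain A]
    [CommRing B] [IsDomain B] (f : A →+* B) (hf : f.FinitePresentation)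
    (hinj : Function.Injective f) :
    ∃ a : A, a ≠ 0 ∧ ∀ p : PrimeSpectrum A, a ∉ p.asIdeal →
      ∃ q : PrimeSpectrum B, PrimeSpectrum.comap f q = p := by
  obtain ⟨S, hS⟩ := PrimeSpectrum.exists_constructibleSetData_iff.2
    (PrimeSpectrum.isConstructible_range_comap hf)
  have hbot : (⊥ : PrimeSpectrum A) ∈ Set.range (PrimeSpectrum.comap f) :=
    ⟨⊥, by ext x; simp [map_eq_zero_iff f hinj]⟩
  rw [← hS, PrimeSpectrum.ConstructibleSetData.toSet, Set.mem_iUnion₂] at hbot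
  obtain ⟨C, hC, hbot⟩ := hbot
  -- The generic point lies in the locally closed piece given by `C`, so its closed conditions are
  -- all trivial and the piece is a basic open set.
  have h1 : ∀ k, C.g k = 0 := by
    intro k
    have := hbot.1 (Set.mem_range_self k)
    simpa using this
  refine ⟨C.f, fun h0 => hbot.2 (by simp [h0]), fun p hp => ?_⟩
  have : p ∈ S.toSet := by
    rw [PrimeSpectrum.ConstructibleSetData.toSet, Set.mem_iUnion₂]
    refine ⟨C, hC, ?_, ?_⟩
    · rintro _ ⟨k, rfl⟩
      simp [h1 k]
    · simpa using hp
  rw [hS] at this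
  exact this

variable {K : Type*} [Field K] {N M : ℕ}

/-- Every `y_i` satisfies a nonzero polynomial over `K[x*]` modulo `I`. -/
def IsAlgebraicMod (I : Ideal (LaurentPoly K N M)) : Prop :=
  ∀ i : Fin M, ∃ p : Polynomial (Laurent K N), p ≠ 0 ∧ p.eval₂ C (X i) ∈ I

/-- The inclusion of `ℕ^N` in `ℤ^N`. -/
def exponentHom (N : ℕ) : (Fin N →₀ ℕ) →+ (Fin N → ℤ) where
  toFun n := fun j => (n j : ℤ)
  map_zero' := by ext; simp
  map_add' a b := by ext; simp

theorem exponentHom_injective (N : ℕ) : Function.Injective (exponentHom N) := fun a b h => by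
  ext j
  exact Int.ofNat.inj (congrFun h j)

/-- The inclusion of `K[x]` in `K[x*]`. -/
def inclusionX (K : Type*) [Field K] (N : ℕ) : MvPolynomial (Fin N) K →+* Laurent K N :=
  AddMonoidAlgebra.mapDomainRingHom K (exponentHom N)

theorem inclusionX_injective : Function.Injective (inclusionX K N) :=
  AddMonoidAlgebra.mapDomain_injective (exponentHom_injective N)

theorem inclusionX_monomial (n : Fin N →₀ ℕ) (a : K) :
    inclusionX K N (monomial n a) = AddMonoidAlgebra.single (exponentHom N n) a :=
  AddMonoidAlgebra.mapDomain_single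

theorem inclusion_rename (p : MvPolynomial (Fin N) K) :
    inclusion K N M (rename Sum.inl p) = C (inclusionX K N p) := by
  have : (inclusion K N M).comp (rename (R := K) (Sum.inl : Fin N → Fin N ⊕ Fin M)).toRingHom =
      C.comp (inclusionX K N) := by
    refine MvPolynomial.ringHom_ext (fun a => ?_) fun j => ?_
    · have : inclusionX K N (C a) = algebraMap K (Laurent K N) a := by
        rw [C_apply, inclusionX_monomial, map_zero]
        rfl
      simp [inclusion, this]
    · have : inclusionX K N (X j) = AddMonoidAlgebra.single (Pi.single j 1) 1 := by
        rw [X, inclusionX_monomial]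
        congr 1
        ext k
        simp [exponentHom, Finsupp.single_apply, Pi.single_apply, eq_comm]
      simp [inclusion, this]
  exact RingHom.congr_fun this p

/-- The homomorphism `K[x][T] → K[x, y]`, `T ↦ y_i`. -/
def toVariable (K : Type*) [Field K] (N : ℕ) {M : ℕ} (i : Fin M) :
    Polynomial (MvPolynomial (Fin N) K) →+* MvPolynomial (Fin N ⊕ Fin M) K :=
  Polynomial.eval₂RingHom (rename Sum.inl).toRingHom (X (Sum.inr i))

theorem inclusion_toVariable (i : Fin M) (p : Polynomial (MvPolynomial (Fin N) K)) :
    inclusion K N M (toVariable K N i p) = (p.map (inclusionX K N)).eval₂ C (X i) := by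
  have : (inclusion K N M).comp (toVariable K N i) =
      (Polynomial.eval₂RingHom C (X i)).comp (Polynomial.mapRingHom (inclusionX K N)) := by
    refine Polynomial.ringHom_ext (fun a => ?_) ?_
    · simp [toVariable, inclusion_rename]
    · simp [toVariable, inclusion]
  exact RingHom.congr_fun this p

theorem eval_toVariable (i : Fin M) (p : Polynomial (MvPolynomial (Fin N) K)) (x : Fin N → K)
    (y : Fin M → K) :
    eval (Sum.elim x y) (toVariable K N i p) = (p.map (eval x)).eval (y i) := by
  have : (eval (Sum.elim x y)).comp (toVariable K N i) =
      (Polynomial.evalRingHom (y i)).comp (Polynomial.mapRingHom (eval x)) := by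
    refine Polynomial.ringHom_ext (fun a => ?_) ?_
    · simp [toVariable, eval_rename, Function.comp_def]
    · simp [toVariable]
  exact RingHom.congr_fun this p

theorem exists_inclusionX_eq (a : Laurent K N) :
    ∃ (n : Fin N →₀ ℕ) (b : MvPolynomial (Fin N) K),
      inclusionX K N b = AddMonoidAlgebra.single (exponentHom N n) 1 * a := by
  induction a using AddMonoidAlgebra.induction_linear with
  | zero => exact ⟨0, 0, by simp⟩
  | add a a' h h' =>
    obtain ⟨n, b, hb⟩ := h
    obtain ⟨n', b', hb'⟩ := h'
    refine ⟨n + n', monomial n' 1 * b + monomial n 1 * b', ?_⟩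
    rw [map_add, map_mul, map_mul, hb, hb', inclusionX_monomial, inclusionX_monomial, ← mul_assoc,
      ← mul_assoc, AddMonoidAlgebra.single_mul_single, AddMonoidAlgebra.single_mul_single, map_add,
      mul_add, add_comm (exponentHom N n'), mul_one]
  | single α k =>
    refine ⟨Finsupp.equivFunOnFinite.symm fun j => (α j).natAbs,
      monomial (Finsupp.equivFunOnFinite.symm fun j => (α j + (α j).natAbs).toNat) k, ?_⟩
    rw [inclusionX_monomial, AddMonoidAlgebra.single_mul_single, one_mul]
    congr 1
    ext j
    simp only [exponentHom, AddMonoidHom.coe_mk, ZeroHom.coe_mk, Pi.add_apply,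
      Finsupp.coe_equivFunOnFinite_symm]
    omega

theorem exists_map_inclusionX_eq (p : Polynomial (Laurent K N)) :
    ∃ (n : Fin N →₀ ℕ) (q : Polynomial (MvPolynomial (Fin N) K)),
      q.map (inclusionX K N) =
        Polynomial.C (AddMonoidAlgebra.single (exponentHom N n) 1) * p := by
  induction p using Polynomial.induction_on' with
  | add p p' h h' =>
    obtain ⟨n, b, hb⟩ := h
    obtain ⟨n', b', hb'⟩ := h'
    refine ⟨n + n', Polynomial.C (monomial n' 1) * b + Polynomial.C (monomial n 1) * b', ?_⟩
    rw [Polynomial.map_add, Polynomial.map_mul, Polynomial.map_mul, hb, hb', Polynomial.map_C,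
      Polynomial.map_C, inclusionX_monomial, inclusionX_monomial, ← mul_assoc, ← mul_assoc,
      ← Polynomial.C_mul, ← Polynomial.C_mul, AddMonoidAlgebra.single_mul_single,
      AddMonoidAlgebra.single_mul_single, map_add, mul_add, add_comm (exponentHom N n'), mul_one]
  | monomial k a =>
    obtain ⟨n, b, hb⟩ := exists_inclusionX_eq a
    exact ⟨n, Polynomial.monomial k b, by
      rw [Polynomial.map_monomial, hb, Polynomial.C_mul_monomial]⟩

theorem aeval_eq_eval_self {σ : Type*} (z : σ → K) (f : MvPolynomial σ K) :
    aeval z f = eval z f := by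
  rw [← coe_aeval_eq_eval]
  rfl

theorem isUnit_single (α : Fin N → ℤ) {a : K} (ha : a ≠ 0) :
    IsUnit (AddMonoidAlgebra.single α a : Laurent K N) := by
  refine IsUnit.of_mul_eq_one (AddMonoidAlgebra.single (-α) a⁻¹) ?_
  rw [AddMonoidAlgebra.single_mul_single, add_neg_cancel, mul_inv_cancel₀ ha]
  rfl

theorem IsAlgebraicMod.exists_toVariable_mem {I : Ideal (LaurentPoly K N M)}
    (h : IsAlgebraicMod I) (i : Fin M) :
    ∃ p : Polynomial (MvPolynomial (Fin N) K), p ≠ 0 ∧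
      toVariable K N i p ∈ I.comap (inclusion K N M) := by
  obtain ⟨p, hp0, hp⟩ := h i
  obtain ⟨n, q, hq⟩ := exists_map_inclusionX_eq p
  refine ⟨q, ?_, ?_⟩
  · rintro rfl
    rw [Polynomial.map_zero, eq_comm,
      ((isUnit_single _ one_ne_zero).map Polynomial.C).mul_right_eq_zero] at hq
    exact hp0 hq
  · rw [Ideal.mem_comap, inclusion_toVariable, hq, Polynomial.eval₂_mul]
    exact I.mul_mem_left _ hp

/-- An ideal of `K[x*, y]` that meets `K[x*]` trivially and modulo which the `y_i` are algebraic is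
`N`-admissible. -/
theorem IsAlgebraicMod.isNAdmissible [IsAlgClosed K] {I : Ideal (LaurentPoly K N M)}
    (h : IsAlgebraicMod I) (h0 : ∀ a : Laurent K N, C a ∈ I → a = 0) : IsNAdmissible I := by
  constructor
  · intro p hp
    -- As a polynomial in `(x, y)`, `p` vanishes on the zero set; the Nullstellensatz puts a power
    -- of it in the ideal, and that power lies in `K[x*]`.
    have h1 : rename Sum.inl p ∈
        vanishingIdeal K (zeroLocus K (I.comap (inclusion K N M))) := by
      intro z hz
      have := hp (z ∘ Sum.inl) ⟨(z ∘ Sum.inl, z ∘ Sum.inr), fun f hf => by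
        simpa [Sum.elim_comp_inl_inr, aeval_eq_eval_self] using hz f hf, rfl⟩
      rwa [aeval_eq_eval_self, eval_rename]
    rw [vanishingIdeal_zeroLocus_eq_radical] at h1
    obtain ⟨n, hn⟩ := h1
    rw [Ideal.mem_comap, map_pow, inclusion_rename, ← map_pow C] at hn
    have h2 : p ^ n = 0 :=
      inclusionX_injective ((map_pow _ _ _).trans ((h0 _ hn).trans (map_zero _).symm))
    exact eq_zero_of_pow_eq_zero h2
  · choose p hp0 hp using h.exists_toVariable_mem
    -- Where no leading coefficient vanishes, each `y_i` is a root of a nonzero one-variable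
    -- polynomial.
    refine ⟨∏ i, (p i).leadingCoeff, Finset.prod_ne_zero_iff.2 fun i _ => by simpa using hp0 i,
      fun x hx => ?_⟩
    rw [map_prod, Finset.prod_ne_zero_iff] at hx
    have hne : ∀ i, (p i).map (eval x) ≠ 0 := fun i hi => hx i (Finset.mem_univ i) (by
      rw [Polynomial.leadingCoeff, ← Polynomial.coeff_map, hi, Polynomial.coeff_zero])
    refine (Set.Finite.pi fun i => Polynomial.finite_setOfPred_isRoot (hne i)).subset
      fun y hy i _ => ?_
    have := hy _ (hp i)
    rwa [eval_toVariable] at this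

/-- Modulo an ideal with finite generic fibres the `y_i` are algebraic over `K[x*]`. -/
theorem IsNAdmissible.isAlgebraicMod [IsAlgClosed K] {I : Ideal (LaurentPoly K N M)}
    (h : IsNAdmissible I) : IsAlgebraicMod I := by
  intro i
  by_contra! hI
  obtain ⟨-, q, hq0, hq⟩ := h
  have hdisj : Disjoint (I.comap (inclusion K N M) : Set (MvPolynomial (Fin N ⊕ Fin M) K))
      ((nonZeroDivisors (Polynomial (MvPolynomial (Fin N) K))).map (toVariable K N i)) := by
    rw [Set.disjoint_left]
    rintro _ hf ⟨p, hp, rfl⟩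
    rw [SetLike.mem_coe, Ideal.mem_comap, inclusion_toVariable] at hf
    refine hI (p.map (inclusionX K N)) ?_ hf
    rw [Ne, Polynomial.map_eq_zero_iff inclusionX_injective]
    exact nonZeroDivisors.ne_zero hp
  -- If `y_i` is transcendental modulo `I`, it remains so modulo a suitable prime `P`: `K[x][T]`
  -- embeds in the quotient by `P`.
  obtain ⟨P, hP, hIP, hPd⟩ := Ideal.exists_le_prime_disjoint _ _ hdisj
  have hinj : Function.Injective ((Ideal.Quotient.mk P).comp (toVariable K N i)) := by
    rw [injective_iff_map_eq_zero]
    intro p hp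
    by_contra hp0
    exact Set.disjoint_left.1 hPd (Ideal.Quotient.eq_zero_iff_mem.1 hp)
      ⟨p, mem_nonZeroDivisors_of_ne_zero hp0, rfl⟩
  have hfin : ((Ideal.Quotient.mk P).comp (toVariable K N i)).FinitePresentation := by
    refine RingHom.FinitePresentation.of_finiteType.1 ?_
    have h2 : (algebraMap K (MvPolynomial (Fin N ⊕ Fin M) K ⧸ P)).FiniteType :=
      (RingHom.finiteType_algebraMap).2 inferInstance
    have h3 : algebraMap K (MvPolynomial (Fin N ⊕ Fin M) K ⧸ P) =
        ((Ideal.Quotient.mk P).comp (toVariable K N i)).comp (Polynomial.C.comp C) := by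
      ext a
      simp [toVariable]
      rfl
    rw [h3] at h2
    exact RingHom.FiniteType.of_comp_finiteType h2
  obtain ⟨a, ha0, ha⟩ := exists_ne_zero_forall_exists_comap_eq _ hfin hinj
  obtain ⟨x, hx⟩ : ∃ x, eval x (q * a.leadingCoeff) ≠ 0 := by
    by_contra! hx
    exact mul_ne_zero hq0 (Polynomial.leadingCoeff_ne_zero.2 ha0)
      (MvPolynomial.funext fun x => by simpa using hx x)
  rw [map_mul, mul_ne_zero_iff] at hx
  have hane : a.map (eval x) ≠ 0 := fun h0 => hx.2 (by
    rw [Polynomial.leadingCoeff, ← Polynomial.coeff_map, h0, Polynomial.coeff_zero])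
  -- By Chevalley every `t` that is not a root of `a(x, ·)` is the `i`-th coordinate of a point over
  -- `x`; this makes the finite fibre infinite.
  refine (Polynomial.finite_setOfPred_isRoot hane).infinite_compl
    (((hq x hx.1).image fun y => y i).subset fun t ht => ?_)
  let ψ : Polynomial (MvPolynomial (Fin N) K) →+* K :=
    (Polynomial.evalRingHom t).comp (Polynomial.mapRingHom (eval x))
  obtain ⟨Q, hQ⟩ := ha ⟨RingHom.ker ψ, RingHom.ker_isPrime ψ⟩ (by simpa [ψ] using ht)
  obtain ⟨m, hm, hQm⟩ := (Q.asIdeal.comap (Ideal.Quotient.mk P)).exists_le_maximal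
    (Ideal.IsPrime.ne_top inferInstance)
  -- The Nullstellensatz turns a maximal ideal above `Q` into a point; the kernel of `ψ` fixes its
  -- coordinates `x` and `y_i = t`.
  obtain ⟨z, rfl⟩ := (isMaximal_iff_eq_vanishingIdeal_singleton (K := K)).1 hm
  have hz : ∀ f ∈ P, eval z f = 0 := fun f hf => by
    have := hQm (show f ∈ Q.asIdeal.comap (Ideal.Quotient.mk P) by
      rw [Ideal.mem_comap, Ideal.Quotient.eq_zero_iff_mem.2 hf]
      exact zero_mem _)
    rwa [mem_vanishingIdeal_singleton_iff, aeval_eq_eval_self] at this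
  have hz' : ∀ p, ψ p = 0 → eval z (toVariable K N i p) = 0 := fun p hp => by
    have h4 : p ∈ (PrimeSpectrum.comap
        ((Ideal.Quotient.mk P).comp (toVariable K N i)) Q).asIdeal := by
      rw [hQ]
      exact hp
    have := hQm (show toVariable K N i p ∈ Q.asIdeal.comap (Ideal.Quotient.mk P) from h4)
    rwa [mem_vanishingIdeal_singleton_iff, aeval_eq_eval_self] at this
  have hzx : z ∘ Sum.inl = x := by
    ext j
    have := hz' (Polynomial.C (X j - C (x j))) (by simp [ψ])
    simpa [toVariable, sub_eq_zero] using this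
  have hzt : z (Sum.inr i) = t := by
    have := hz' (Polynomial.X - Polynomial.C (C t)) (by simp [ψ])
    simpa [toVariable, sub_eq_zero] using this
  refine ⟨z ∘ Sum.inr, fun f hf => ?_, hzt⟩
  have := hz f (hIP hf)
  simpa [← hzx, Sum.elim_comp_inl_inr] using this

/-- On a relation for `y_i` the substitution acts as `x ↦ x^d` on coefficients followed by a Taylor
shift in `y_i`. Both operations are injective, so the relation stays nonzero. -/
theorem IsAlgebraicMod.transform {ω : Fin N → ℝ} {I : Ideal (LaurentPoly K N M)}
    (h : IsAlgebraicMod I) (D : OmegaSet K M ω) : IsAlgebraicMod (transform I D) := by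
  intro i
  obtain ⟨p, hp0, hp⟩ := h i
  let ρ := AddMonoidAlgebra.mapDomainRingHom K
    (nsmulAddMonoidHom (α := Fin N → ℤ) (denom D.Γ))
  have hρ : Function.Injective ρ := by
    refine AddMonoidAlgebra.mapDomain_injective fun a b hab => ?_
    exact smul_right_injective (Fin N → ℤ) (denom_pos D.Γ).ne' hab
  let s : Laurent K N := AddMonoidAlgebra.single (scaledRow D.Γ i) (D.c i)
  refine ⟨Polynomial.taylor s (p.map ρ), ?_, ?_⟩
  · rw [Ne, (Polynomial.taylor_injective s).eq_iff' (map_zero _),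
      Polynomial.map_eq_zero_iff hρ]
    exact hp0
  · have h1 : substitution D (p.eval₂ C (X i)) =
        (Polynomial.taylor s (p.map ρ)).eval₂ C (X i) := by
      rw [Polynomial.taylor_apply, Polynomial.eval₂_comp, Polynomial.eval₂_map,
        Polynomial.hom_eval₂]
      congr 1
      · ext a <;> simp [substitution, ρ]
      · simp [substitution, s]
    rw [← h1]
    exact Ideal.subset_span ⟨_, hp, rfl⟩

end Admissibility

/-! ### Weights of monomials and linear functionals on `K[x*, y]`. -/

section Weights

open MvPolynomial

variable {K : Type*} [Field K] {N M : ℕ}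

/-- The linear form `α ↦ ω · α` on `ℤ^N`. -/
def dot (ω : Fin N → ℝ) : (Fin N → ℤ) →+ ℝ where
  toFun α := ∑ j, ω j * (α j : ℝ)
  map_zero' := by simp
  map_add' α β := by simp [mul_add, Finset.sum_add_distrib]

theorem dot_injective {ω : Fin N → ℝ} (hω : LinearIndependent ℚ ω) :
    Function.Injective (dot ω) := by
  rw [injective_iff_map_eq_zero]
  intro α hα
  have := Fintype.linearIndependent_iff.1 hω (fun j => (α j : ℚ)) (by
    rw [← hα]
    simp [dot, Rat.smul_def, mul_comm])
  ext j
  exact_mod_cast this j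

/-- The linear map `β ↦ ∑ i, β i • r i`. -/
def shift (r : Fin M → Fin N → ℤ) : (Fin M →₀ ℕ) →+ (Fin N → ℤ) where
  toFun β := ∑ i, β i • r i
  map_zero' := by simp
  map_add' α β := by simp [add_smul, Finset.sum_add_distrib]

theorem shift_apply (r : Fin M → Fin N → ℤ) (β : Fin M →₀ ℕ) :
    shift r β = ∑ i, β i • r i := rfl

theorem weight_eq_top {ω : Fin N → ℝ} {η : Fin M → WithTop ℝ} (α : Fin N → ℤ) {β : Fin M →₀ ℕ}
    (h : ¬ ∀ i, η i = ⊤ → β i = 0) : weight ω η α β = ⊤ := by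
  push Not at h
  obtain ⟨i, hi, hβ⟩ := h
  rw [weight, WithTop.add_eq_top, WithTop.sum_eq_top]
  refine Or.inr ⟨i, Finset.mem_univ i, ?_⟩
  rw [hi, WithTop.mul_top]
  exact_mod_cast hβ

theorem weight_eq_coe {ω : Fin N → ℝ} {η : Fin M → WithTop ℝ} (α : Fin N → ℤ) {β : Fin M →₀ ℕ}
    (h : ∀ i, η i = ⊤ → β i = 0) :
    weight ω η α β = ((dot ω α + ∑ i, β i * (η i).untopD 0 : ℝ) : WithTop ℝ) := by
  change ((dot ω α : ℝ) : WithTop ℝ) + _ = _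
  rw [WithTop.coe_add, WithTop.coe_sum]
  refine congrArg₂ (· + ·) rfl (Finset.sum_congr rfl fun i _ => ?_)
  cases hi : η i with
  | top => simp [h i hi]
  | coe e => simp

/-- `r` is integral and `ω · r = d η` in the finite rows of `η`. -/
structure IsScaling (ω : Fin N → ℝ) (η : Fin M → WithTop ℝ) (d : ℕ) (r : Fin M → Fin N → ℤ) :
    Prop where
  pos : 0 < d
  dot_eq : ∀ i, dot ω (r i) = d * (η i).untopD 0
  eq_zero : ∀ i, η i = ⊤ → r i = 0

theorem OmegaSet.isScaling {ω : Fin N → ℝ} (hω : LinearIndependent ℚ ω) (D : OmegaSet K M ω) :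
    IsScaling ω D.η (denom D.Γ) (scaledRow D.Γ) := by
  have h0 : ∀ i, D.η i = ⊤ → scaledRow D.Γ i = 0 := fun i hi => by
    ext j
    simp [scaledRow, D.row_eq_top i hi j]
  refine ⟨denom_pos _, fun i => ?_, h0⟩
  by_cases hi : D.η i = ⊤
  · simp [h0 i hi, hi]
  · have h := D.dot_eq i hi
    have hfin : ∀ j, D.Γ i j ≠ ⊤ := by
      intro j hj
      refine hi (h ▸ WithTop.sum_eq_top.2 ⟨j, Finset.mem_univ j, ?_⟩)
      rw [hj, WithTop.map_top, WithTop.mul_top]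
      exact_mod_cast hω.ne_zero j
    have h2 : D.η i = ((∑ j, ω j * (((D.Γ i j).untopD 0 : ℚ) : ℝ) : ℝ) : WithTop ℝ) := by
      rw [← h, WithTop.coe_sum]
      refine Finset.sum_congr rfl fun j _ => ?_
      obtain ⟨q, hq⟩ := WithTop.ne_top_iff_exists.1 (hfin j)
      simp [← hq]
    rw [h2, WithTop.untopD_coe, Finset.mul_sum]
    change ∑ j, ω j * (scaledRow D.Γ i j : ℝ) = _
    refine Finset.sum_congr rfl fun j _ => ?_
    have := scaledRow_cast D.Γ i j
    have h3 : (scaledRow D.Γ i j : ℝ) = (denom D.Γ : ℝ) * (((D.Γ i j).untopD 0 : ℚ) : ℝ) := by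
      exact_mod_cast congrArg (Rat.cast : ℚ → ℝ) this
    rw [h3]
    ring

/-- Substituting `x ↦ x^d` and `y_i ↦ x^{r_i} t_i` turns `x^α y^β` into a monomial in `t` times `x`
to the exponent `d • α + shift r β`; its `ω`-order is `d` times the weight. -/
theorem IsScaling.weight_eq {ω : Fin N → ℝ} {η : Fin M → WithTop ℝ} {d : ℕ}
    {r : Fin M → Fin N → ℤ} (h : IsScaling ω η d r) (α : Fin N → ℤ) {β : Fin M →₀ ℕ}
    (hβ : ∀ i, η i = ⊤ → β i = 0) :
    weight ω η α β = ((dot ω (d • α + shift r β) / d : ℝ) : WithTop ℝ) := by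
  rw [weight_eq_coe α hβ]
  congr 1
  have hd : (d : ℝ) ≠ 0 := by exact_mod_cast h.pos.ne'
  rw [map_add, map_nsmul, shift_apply, map_sum, nsmul_eq_mul,
    add_div, mul_div_cancel_left₀ _ hd, Finset.sum_div]
  refine congrArg₂ (· + ·) rfl (Finset.sum_congr rfl fun i _ => ?_)
  rw [map_nsmul, h.dot_eq, nsmul_eq_mul]
  field_simp

theorem monomial_single_induction {G : Type*} [AddCommMonoid G]
    {p : MvPolynomial (Fin M) (AddMonoidAlgebra K G) → Prop}
    (f : MvPolynomial (Fin M) (AddMonoidAlgebra K G)) (h0 : p 0)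
    (hadd : ∀ f g, p f → p g → p (f + g))
    (h : ∀ β α k, p (monomial β (AddMonoidAlgebra.single α k))) : p f := by
  induction f using MvPolynomial.induction_on' with
  | monomial β a =>
    induction a using AddMonoidAlgebra.induction_linear with
    | zero => simpa using h0
    | add a b ha hb => simpa using hadd _ _ ha hb
    | single α k => exact h β α k
  | add f g hf hg => exact hadd _ _ hf hg

theorem laurentPoly_addHom_ext {G A : Type*} [AddCommMonoid G] [AddCommMonoid A]
    {f g : MvPolynomial (Fin M) (AddMonoidAlgebra K G) →+ A}
    (h : ∀ β α k, f (monomial β (AddMonoidAlgebra.single α k)) =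
      g (monomial β (AddMonoidAlgebra.single α k))) : f = g := by
  refine AddMonoidHom.ext fun p => ?_
  induction p using monomial_single_induction with
  | h0 => simp
  | hadd f g hf hg => simp [hf, hg]
  | h β α k => exact h β α k

/-- The linear functional on `K[x*, y]` with the value `u β α` at `x^α y^β`. -/
def functional (u : (Fin M →₀ ℕ) → (Fin N → ℤ) → K) : LaurentPoly K N M →+ K :=
  (Finsupp.liftAddHom fun β =>
    (Finsupp.liftAddHom fun α => AddMonoidHom.mulRight (u β α)).comp
      AddMonoidAlgebra.coeffAddEquiv.toAddMonoidHom).comp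
    (AddMonoidAlgebra.coeffAddEquiv (R := Laurent K N) (M := Fin M →₀ ℕ)).toAddMonoidHom

theorem functional_apply (u : (Fin M →₀ ℕ) → (Fin N → ℤ) → K) (f : LaurentPoly K N M) :
    functional u f =
      ∑ β ∈ f.support, ∑ α ∈ (f.coeff β).coeff.support, (f.coeff β).coeff α * u β α := rfl

theorem functional_monomial (u : (Fin M →₀ ℕ) → (Fin N → ℤ) → K) (β : Fin M →₀ ℕ)
    (α : Fin N → ℤ) (k : K) :
    functional u (monomial β (AddMonoidAlgebra.single α k)) = k * u β α := by
  simp [functional, monomial]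

theorem evalOne_monomial (c : Fin M → K) (β : Fin M →₀ ℕ) (α : Fin N → ℤ) (k : K) :
    evalOne c (monomial β (AddMonoidAlgebra.single α k)) = k * ∏ i, c i ^ β i := by
  simp [evalOne, Finsupp.prod_fintype]

end Weights

/-! ### Initial parts and the decomposition of exponents modulo `d`. -/

section Initial

open MvPolynomial

variable {K : Type*} [Field K] {N M : ℕ}

open Classical in
/-- The values at monomials of the functional reading off the value at `(1, c)` of the part of
`x^κ f(x^d, y)` of weight `0`. -/
def slice (η : Fin M → WithTop ℝ) (c : Fin M → K) (d : ℕ) (r : Fin M → Fin N → ℤ)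
    (κ : Fin N → ℤ) (β : Fin M →₀ ℕ) (α : Fin N → ℤ) : K :=
  if (∀ i, η i = ⊤ → β i = 0) ∧ κ + (d • α + shift r β) = 0 then ∏ i, c i ^ β i else 0

theorem evalOne_initialPart (ω : Fin N → ℝ) (η : Fin M → WithTop ℝ) (c : Fin M → K)
    (f : LaurentPoly K N M) (h : polyOrder ω η f ≠ ⊤) :
    evalOne c (initialPart ω η f) = ∑ β ∈ f.support,
      ∑ α ∈ (f.coeff β).coeff.support with weight ω η α β = polyOrder ω η f,
        (f.coeff β).coeff α * ∏ i, c i ^ β i := by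
  classical
  rw [initialPart, if_neg h, map_sum]
  refine Finset.sum_congr rfl fun β _ => ?_
  rw [map_sum]
  refine Finset.sum_congr (by congr) fun α _ => evalOne_monomial c β α _

theorem polyOrder_le (ω : Fin N → ℝ) (η : Fin M → WithTop ℝ) (f : LaurentPoly K N M)
    {β : Fin M →₀ ℕ} {α : Fin N → ℤ} (h : (f.coeff β).coeff α ≠ 0) :
    polyOrder ω η f ≤ weight ω η α β := by
  refine (Finset.inf_le (mem_support_iff.2 fun h0 => h ?_)).trans
    (Finset.inf_le (Finsupp.mem_support_iff.2 h))
  rw [h0]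
  rfl

theorem exists_weight_eq_polyOrder (ω : Fin N → ℝ) (η : Fin M → WithTop ℝ)
    (f : LaurentPoly K N M) (h : polyOrder ω η f ≠ ⊤) :
    ∃ β α, (f.coeff β).coeff α ≠ 0 ∧ weight ω η α β = polyOrder ω η f := by
  have h1 : f.support.Nonempty := by
    rw [Finset.nonempty_iff_ne_empty]
    rintro h0
    exact h (by rw [polyOrder, h0, Finset.inf_empty])
  obtain ⟨β, -, hβ'⟩ := Finset.exists_mem_eq_inf _ h1
    fun β => (f.coeff β).coeff.support.inf fun α => weight ω η α β
  have h2 : (f.coeff β).coeff.support.Nonempty := by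
    rw [Finset.nonempty_iff_ne_empty]
    rintro h0
    exact h (by rw [polyOrder, hβ', h0, Finset.inf_empty])
  obtain ⟨α, hα, hα'⟩ := Finset.exists_mem_eq_inf _ h2 fun α => weight ω η α β
  exact ⟨β, α, Finsupp.mem_support_iff.1 hα, by rw [← hα', ← hβ']; rfl⟩

/-- Rational independence of `ω` makes a finite weight determine the integral vector `d • α + shift
r β`, so conditions on weights become equations in `ℤ^N`. -/
theorem IsScaling.add_eq_zero_iff {ω : Fin N → ℝ} (hω : LinearIndependent ℚ ω)
    {η : Fin M → WithTop ℝ} {d : ℕ} {r : Fin M → Fin N → ℤ} (h : IsScaling ω η d r)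
    (κ α : Fin N → ℤ) {β : Fin M →₀ ℕ} (hβ : ∀ i, η i = ⊤ → β i = 0) :
    κ + (d • α + shift r β) = 0 ↔
      weight ω η α β = ((-dot ω κ / d : ℝ) : WithTop ℝ) := by
  have hd : (0 : ℝ) < d := by exact_mod_cast h.pos
  rw [h.weight_eq α hβ, WithTop.coe_inj, div_left_inj' hd.ne', ← (dot_injective hω).eq_iff, map_add,
    map_zero, eq_neg_iff_add_eq_zero, add_comm]

theorem IsScaling.evalOne_initialPart_eq_functional {ω : Fin N → ℝ} (hω : LinearIndependent ℚ ω)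
    {η : Fin M → WithTop ℝ} {d : ℕ} {r : Fin M → Fin N → ℤ} (h : IsScaling ω η d r)
    (c : Fin M → K) {f : LaurentPoly K N M} {κ : Fin N → ℤ}
    (hκ : polyOrder ω η f = ((-dot ω κ / d : ℝ) : WithTop ℝ)) :
    evalOne c (initialPart ω η f) = functional (slice η c d r κ) f := by
  classical
  rw [evalOne_initialPart ω η c f (hκ ▸ WithTop.coe_ne_top), functional_apply]
  refine Finset.sum_congr rfl fun β _ => ?_
  rw [Finset.sum_filter]
  refine Finset.sum_congr rfl fun α _ => ?_
  rw [slice, mul_ite, mul_zero]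
  refine if_congr ?_ rfl rfl
  rw [hκ]
  by_cases hβ : ∀ i, η i = ⊤ → β i = 0
  · rw [h.add_eq_zero_iff hω κ α hβ]
    exact (and_iff_right hβ).symm
  · rw [weight_eq_top α hβ]
    exact iff_of_false WithTop.top_ne_coe fun h => hβ h.1

/-- By `hκ` the order of `f` is at least the weight that `slice` selects. If they agree, the
functional evaluates the initial part; otherwise `f` has no term of that weight. -/
theorem IsScaling.functional_slice_eq_zero {ω : Fin N → ℝ} (hω : LinearIndependent ℚ ω)
    {η : Fin M → WithTop ℝ} {d : ℕ} {r : Fin M → Fin N → ℤ} (h : IsScaling ω η d r)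
    {c : Fin M → K} {f : LaurentPoly K N M} (hf : evalOne c (initialPart ω η f) = 0)
    (κ : Fin N → ℤ) (hκ : ∀ β α, (f.coeff β).coeff α ≠ 0 → (∀ i, η i = ⊤ → β i = 0) →
      0 ≤ dot ω (κ + (d • α + shift r β))) :
    functional (slice η c d r κ) f = 0 := by
  classical
  have hle : ((-dot ω κ / d : ℝ) : WithTop ℝ) ≤ polyOrder ω η f := by
    refine Finset.le_inf fun β _ => Finset.le_inf fun α hα => ?_
    by_cases hβ : ∀ i, η i = ⊤ → β i = 0
    · rw [h.weight_eq α hβ, WithTop.coe_le_coe]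
      have := hκ β α (Finsupp.mem_support_iff.1 hα) hβ
      rw [map_add] at this
      gcongr
      linarith
    · rw [weight_eq_top α hβ]
      exact le_top
  by_cases heq : polyOrder ω η f = ((-dot ω κ / d : ℝ) : WithTop ℝ)
  · rw [← h.evalOne_initialPart_eq_functional hω c heq, hf]
  · refine Finset.sum_eq_zero fun β _ => Finset.sum_eq_zero fun α hα => ?_
    change _ * slice η c d r κ β α = 0
    rw [slice, if_neg, mul_zero]
    rintro ⟨hβ, hβα⟩
    refine heq (le_antisymm ?_ hle)
    exact (polyOrder_le ω η f (Finsupp.mem_support_iff.1 hα)).trans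
      ((h.add_eq_zero_iff hω κ α hβ).1 hβα).le

theorem affine_injective {d : ℕ} (hd : 0 < d) (κ : Fin N → ℤ) :
    Function.Injective fun γ : Fin N → ℤ => κ + d • γ := fun _ _ h =>
  smul_right_injective (Fin N → ℤ) hd.ne' (add_left_cancel h)

/-- The additive map `∑ a_{α,β} x^α y^β ↦ ∑ a_{κ+dγ,β} x^γ y^β`. -/
def residuePart {d : ℕ} (hd : 0 < d) (κ : Fin N → ℤ) : LaurentPoly K N M →+ LaurentPoly K N M where
  toFun := AddMonoidAlgebra.map
    (AddMonoidAlgebra.comapDomainAddMonoidHom _ (affine_injective hd κ))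
  map_zero' := AddMonoidAlgebra.map_zero _
  map_add' := AddMonoidAlgebra.map_add _

theorem coeff_residuePart {d : ℕ} (hd : 0 < d) (κ : Fin N → ℤ) (f : LaurentPoly K N M)
    (β : Fin M →₀ ℕ) : (residuePart hd κ f).coeff β =
      AddMonoidAlgebra.comapDomain _ (affine_injective hd κ) (f.coeff β) := rfl

/-- The endomorphism `x ↦ x^d` of `K[x*]`. -/
def power (K : Type*) [Field K] (N d : ℕ) : Laurent K N →+* Laurent K N :=
  AddMonoidAlgebra.mapDomainRingHom K (nsmulAddMonoidHom (α := Fin N → ℤ) d)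

/-- Multiplying by a series of exponents in `d ℤ^N` preserves the class of an exponent modulo `d`.
-/
theorem comapDomain_power_mul {d : ℕ} (hd : 0 < d) (κ : Fin N → ℤ) (a b : Laurent K N) :
    AddMonoidAlgebra.comapDomain _ (affine_injective hd κ) (power K N d a * b) =
      a * AddMonoidAlgebra.comapDomain _ (affine_injective hd κ) b := by
  induction a using AddMonoidAlgebra.induction_linear with
  | zero => simp
  | add a a' h h' => rw [map_add, add_mul, AddMonoidAlgebra.comapDomain_add, h, h', add_mul]
  | single α k =>
    have : power K N d (AddMonoidAlgebra.single α k) = AddMonoidAlgebra.single (d • α) k :=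
      AddMonoidAlgebra.mapDomain_single
    rw [this]
    ext γ
    rw [AddMonoidAlgebra.coeff_comapDomain, Finsupp.comapDomain_apply,
      AddMonoidAlgebra.coeff_single_mul_eq_mul_coeff (m₂ := κ + d • (γ - α)),
      AddMonoidAlgebra.coeff_single_mul_eq_mul_coeff (m₂ := γ - α),
      AddMonoidAlgebra.coeff_comapDomain, Finsupp.comapDomain_apply]
    · intro δ _
      rw [eq_sub_iff_add_eq, add_comm]
    · intro δ _
      rw [smul_sub, ← add_sub_assoc, eq_sub_iff_add_eq, add_comm]

theorem residuePart_map_power_mul {d : ℕ} (hd : 0 < d) (κ : Fin N → ℤ) (f g : LaurentPoly K N M) :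
    residuePart hd κ (MvPolynomial.map (power K N d) f * g) = f * residuePart hd κ g := by
  ext1 β
  rw [coeff_residuePart, coeff_mul, coeff_mul]
  have : ∀ a : Laurent K N, AddMonoidAlgebra.comapDomain _ (affine_injective hd κ) a =
    AddMonoidAlgebra.comapDomainAddMonoidHom _ (affine_injective hd κ) a := fun _ => rfl
  rw [this, map_sum]
  refine Finset.sum_congr rfl fun p _ => ?_
  rw [← this, coeff_map, comapDomain_power_mul hd, coeff_residuePart]

theorem comapDomain_single_of_notMem_range {d : ℕ} (hd : 0 < d) (κ : Fin N → ℤ) {α : Fin N → ℤ}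
    (hα : α ∉ Set.range fun γ : Fin N → ℤ => κ + d • γ) (k : K) :
    AddMonoidAlgebra.comapDomain _ (affine_injective hd κ) (AddMonoidAlgebra.single α k) = 0 := by
  ext γ
  rw [AddMonoidAlgebra.coeff_comapDomain, Finsupp.comapDomain_apply, AddMonoidAlgebra.coeff_single,
    Finsupp.single_eq_of_ne fun h => hα ⟨γ, h⟩]
  rfl

theorem residuePart_mem {d : ℕ} (hd : 0 < d) (κ : Fin N → ℤ) {I : Ideal (LaurentPoly K N M)}
    {g : LaurentPoly K N M} (hg : g ∈ I.map (MvPolynomial.map (σ := Fin M) (power K N d))) :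
    residuePart hd κ g ∈ I := by
  -- `residuePart` is linear only over the polynomials in `x^d` and `y`, so the induction must carry
  -- an arbitrary multiplier `a`.
  suffices ∀ a, residuePart hd κ (a * g) ∈ I by simpa using this 1
  induction hg using Submodule.span_induction with
  | mem _ h =>
    obtain ⟨f, hf, rfl⟩ := h
    intro a
    rw [mul_comm, residuePart_map_power_mul]
    exact I.mul_mem_right _ hf
  | zero => intro a; simp
  | add f g _ _ hf hg =>
    intro a
    rw [mul_add, map_add]
    exact I.add_mem (hf a) (hg a)
  | smul b f _ hf =>
    intro a
    rw [smul_eq_mul, ← mul_assoc]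
    exact hf _

theorem functional_slice_zero_eq_sum {d : ℕ} (hd : 0 < d) (η : Fin M → WithTop ℝ) (c : Fin M → K)
    (r : Fin M → Fin N → ℤ) (f : LaurentPoly K N M) :
    functional (slice η c 1 r 0) f = ∑ κ : Fin N → Fin d,
      functional (slice η c d r fun j => (κ j : ℤ)) (residuePart hd (fun j => (κ j : ℤ)) f) := by
  classical
  have : functional (slice η c 1 r 0) = ∑ κ : Fin N → Fin d,
      (functional (slice η c d r fun j => (κ j : ℤ))).comp
        (residuePart hd (fun j => (κ j : ℤ))) := by
    refine laurentPoly_addHom_ext fun β α k => ?_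
    have hd' : (0 : ℤ) < d := by exact_mod_cast hd
    have hκ₀ : ∀ j, ((α j % d).toNat : ℤ) = α j % d := fun j =>
      Int.toNat_of_nonneg (Int.emod_nonneg _ hd'.ne')
    have hmap : ∀ κ : Fin N → Fin d, residuePart hd (fun j => (κ j : ℤ))
        (monomial β (AddMonoidAlgebra.single α k)) = monomial β (AddMonoidAlgebra.comapDomain _
          (affine_injective hd fun j => (κ j : ℤ)) (AddMonoidAlgebra.single α k)) :=
      fun κ => AddMonoidAlgebra.map_single _ _ _
    -- Only the residue class of `α` modulo `d` contributes to the monomial with exponent `α`.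
    rw [AddMonoidHom.finsetSum_apply, Finset.sum_eq_single (fun j => ⟨(α j % d).toNat, by
      have := Int.emod_lt_of_pos (α j) hd'
      have := hκ₀ j
      omega⟩)]
    · rw [AddMonoidHom.comp_apply, hmap]
      have hα : α = (fun j => ((α j % d).toNat : ℤ)) + d • fun j => α j / d := by
        ext j
        simp only [Pi.add_apply, hκ₀, nsmul_eq_mul]
        exact (Int.emod_add_mul_ediv (α j) d).symm
      simp only
      generalize hκ : (fun j => ((α j % d).toNat : ℤ)) = κ at *
      generalize (fun j => α j / d) = γ at *
      subst hα
      rw [AddMonoidAlgebra.comapDomain_single_map (fun γ : Fin N → ℤ => κ + d • γ)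
        (affine_injective hd κ), functional_monomial, functional_monomial, slice, slice]
      simp [add_assoc]
    · intro κ _ hne
      rw [AddMonoidHom.comp_apply, hmap, comapDomain_single_of_notMem_range hd,
        map_zero, map_zero]
      rintro ⟨γ, rfl⟩
      refine hne (funext fun j => Fin.ext ?_)
      simp [Int.add_mul_emod_self_left, Int.emod_eq_of_lt]
    · simp
  rw [this, AddMonoidHom.finsetSum_apply]
  rfl

end Initial

/-! ### A zero over a valued field with prescribed leading terms. -/

section Lift

open MvPolynomial

variable {K : Type*} [Field K] {N M : ℕ}

/-- The monoid of the `δ ∈ ℤ^N` with `ω · δ ≥ 0`. -/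
def nonnegCone (ω : Fin N → ℝ) : AddSubmonoid (Fin N → ℤ) :=
  (AddSubmonoid.nonneg ℝ).comap (dot ω)

open Classical in
/-- The character of `nonnegCone ω` with the value `0` at the nonzero elements. -/
def zeroCharacter (K : Type*) [Field K] {ω : Fin N → ℝ} (hω : LinearIndependent ℚ ω) :
    Multiplicative (nonnegCone ω) →* K where
  toFun δ := if δ.toAdd = 0 then 1 else 0
  map_one' := by simp
  map_mul' δ δ' := by
    have h : (δ * δ').toAdd = 0 ↔ δ.toAdd = 0 ∧ δ'.toAdd = 0 := by
      have key : ∀ x : nonnegCone ω, x = 0 ↔ dot ω x = 0 := fun x => by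
        rw [← map_zero (dot ω), (dot_injective hω).eq_iff]
        exact Subtype.ext_iff
      rw [toAdd_mul, key, key, key, AddSubmonoid.coe_add, map_add]
      exact add_eq_zero_iff_of_nonneg δ.toAdd.2 δ'.toAdd.2
    rw [if_congr h rfl rfl, ite_and]
    split_ifs <;> simp

/-- The polynomials in `t_i = x^{-r_i} y_i` over the subring of `K[x*]` of the elements of
nonnegative order. -/
abbrev NonnegPoly (K : Type*) [Field K] (ω : Fin N → ℝ) (M : ℕ) : Type _ :=
  MvPolynomial (Fin M) (AddMonoidAlgebra K (nonnegCone ω))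

/-- The homomorphism `x^δ ↦ x^δ`, `t_i ↦ x^{-r_i} y_i`. -/
def toLaurent (K : Type*) [Field K] (ω : Fin N → ℝ) (r : Fin M → Fin N → ℤ) :
    NonnegPoly K ω M →+* LaurentPoly K N M :=
  eval₂Hom (C.comp (AddMonoidAlgebra.mapDomainRingHom K (nonnegCone ω).subtype))
    fun i => C (AddMonoidAlgebra.single (-r i) 1) * X i

/-- The homomorphism `x^δ ↦ 0` for `δ ≠ 0`, `t_i ↦ c_i`. -/
def residue {ω : Fin N → ℝ} (hω : LinearIndependent ℚ ω) (c : Fin M → K) :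
    NonnegPoly K ω M →+* K :=
  eval₂Hom (AddMonoidAlgebra.lift K K (nonnegCone ω) (zeroCharacter K hω)).toRingHom c

theorem toLaurent_monomial (ω : Fin N → ℝ) (r : Fin M → Fin N → ℤ) (β : Fin M →₀ ℕ)
    (δ : nonnegCone ω) (k : K) :
    toLaurent K ω r (monomial β (AddMonoidAlgebra.single δ k)) =
      monomial β (AddMonoidAlgebra.single (δ - shift r β) k) := by
  have h1 : ∀ i, (AddMonoidAlgebra.single (-r i) 1 : Laurent K N) ^ β i =
      AddMonoidAlgebra.single (β i • -r i) 1 := fun i => by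
    rw [AddMonoidAlgebra.single_pow, one_pow]
  have h2 : ∏ i, (AddMonoidAlgebra.single (β i • -r i) 1 : Laurent K N) =
      AddMonoidAlgebra.single (-shift r β) 1 := by
    rw [AddMonoidAlgebra.prod_single, shift_apply, ← Finset.sum_neg_distrib]
    simp
  have h3 : (AddMonoidAlgebra.mapDomainRingHom K (nonnegCone ω).subtype)
      (AddMonoidAlgebra.single δ k) = AddMonoidAlgebra.single (δ : Fin N → ℤ) k :=
    AddMonoidAlgebra.mapDomain_single
  rw [toLaurent, coe_eval₂Hom, eval₂_monomial, Finsupp.prod_fintype _ _ (by simp)]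
  simp_rw [mul_pow, ← map_pow, h1]
  rw [Finset.prod_mul_distrib, ← map_prod, h2, RingHom.comp_apply, h3, ← mul_assoc, ← map_mul,
    AddMonoidAlgebra.single_mul_single, mul_one, ← sub_eq_add_neg, monomial_eq,
    Finsupp.prod_fintype _ _ (by simp)]

open Classical in
theorem residue_monomial {ω : Fin N → ℝ} (hω : LinearIndependent ℚ ω) (c : Fin M → K)
    (β : Fin M →₀ ℕ) (δ : nonnegCone ω) (k : K) :
    residue hω c (monomial β (AddMonoidAlgebra.single δ k)) =
      k * if δ = 0 then ∏ i, c i ^ β i else 0 := by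
  simp [residue, zeroCharacter, Finsupp.prod_fintype]

theorem dot_nonneg_of_coeff_toLaurent_ne_zero {ω : Fin N → ℝ} (r : Fin M → Fin N → ℤ)
    (g : NonnegPoly K ω M) (β : Fin M →₀ ℕ) (α : Fin N → ℤ)
    (h : ((toLaurent K ω r g).coeff β).coeff α ≠ 0) : 0 ≤ dot ω (α + shift r β) := by
  classical
  revert h
  contrapose!
  intro h
  induction g using monomial_single_induction with
  | h0 => simp
  | hadd f g hf hg => simp [hf, hg]
  | h β' δ k =>
    rw [toLaurent_monomial, coeff_monomial]
    split_ifs with hβ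
    · rw [AddMonoidAlgebra.coeff_single, Finsupp.single_eq_of_ne]
      rintro rfl
      rw [hβ, sub_add_cancel] at h
      exact h.not_ge δ.2
    · rfl

/-- Both sides keep the terms with `δ = 0` and put `t = c`. Terms involving a `y_i` with `η_i = ∞`
are discarded by `slice` on the left and die from `c_i = 0` on the right. -/
theorem functional_toLaurent {ω : Fin N → ℝ} (hω : LinearIndependent ℚ ω) {η : Fin M → WithTop ℝ}
    {c : Fin M → K} (hc : ∀ i, η i = ⊤ → c i = 0) (r : Fin M → Fin N → ℤ)
    (g : NonnegPoly K ω M) :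
    functional (slice η c 1 r 0) (toLaurent K ω r g) = residue hω c g := by
  classical
  have : (functional (slice η c 1 r 0)).comp (toLaurent K ω r).toAddMonoidHom =
      (residue hω c : NonnegPoly K ω M →+* K).toAddMonoidHom := by
    refine laurentPoly_addHom_ext fun β δ k => ?_
    change functional _ (toLaurent K ω r _) = residue hω c _
    rw [toLaurent_monomial, functional_monomial, residue_monomial, slice]
    congr 1
    rw [one_smul, zero_add, sub_add_cancel, ite_and]
    by_cases hβ : ∀ i, η i = ⊤ → β i = 0
    · rw [if_pos hβ]
      refine if_congr ?_ rfl rfl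
      exact (Subtype.ext_iff (a1 := δ) (a2 := 0)).symm
    · rw [if_neg hβ]
      push Not at hβ
      obtain ⟨i, hi, hβi⟩ := hβ
      rw [Finset.prod_eq_zero (Finset.mem_univ i) (by rw [hc i hi, zero_pow hβi]), ite_self]
  exact DFunLike.congr_fun this g

/-- The ideal generated by the `f(x^d, y)`, `f ∈ I`, and the `y_i` with `η_i = ∞`. -/
def extendedIdeal (I : Ideal (LaurentPoly K N M)) (η : Fin M → WithTop ℝ) (d : ℕ) :
    Ideal (LaurentPoly K N M) :=
  I.map (MvPolynomial.map (σ := Fin M) (power K N d)) ⊔ Ideal.span (X '' {i | η i = ⊤})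

/-- The residue is a sum of slices of the residue parts modulo `d`. These parts lie in `I` and have
no terms of negative weight after the shift by `κ`, so `functional_slice_eq_zero` kills each slice.
-/
theorem IsScaling.residue_eq_zero {ω : Fin N → ℝ} (hω : LinearIndependent ℚ ω)
    {η : Fin M → WithTop ℝ} {d : ℕ} {r : Fin M → Fin N → ℤ} (h : IsScaling ω η d r)
    {c : Fin M → K} (hc : ∀ i, η i = ⊤ → c i = 0) {I : Ideal (LaurentPoly K N M)}
    (hI : ∀ f ∈ I, evalOne c (initialPart ω η f) = 0) {g : NonnegPoly K ω M}
    (hg : toLaurent K ω r g ∈ extendedIdeal I η d) : residue hω c g = 0 := by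
  obtain ⟨g₁, hg₁, g₂, hg₂, hsum⟩ := Submodule.mem_sup.1 hg
  have hoff : ∀ β, (∀ i, η i = ⊤ → β i = 0) → g₂.coeff β = 0 := by
    intro β hβ
    by_contra h0
    obtain ⟨i, hi, hβi⟩ := (mem_ideal_span_X_image).1 hg₂ β (mem_support_iff.2 h0)
    exact hβi (hβ i hi)
  have h₂ : functional (slice η c 1 r 0) g₂ = 0 := by
    refine Finset.sum_eq_zero fun β hβ => Finset.sum_eq_zero fun α _ => ?_
    change _ * slice η c 1 r 0 β α = 0
    rw [slice, if_neg, mul_zero]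
    exact fun h => mem_support_iff.1 hβ (hoff β h.1)
  rw [← functional_toLaurent hω hc r, ← hsum, map_add, h₂, add_zero,
    functional_slice_zero_eq_sum h.pos]
  refine Finset.sum_eq_zero fun κ _ => h.functional_slice_eq_zero hω
    (hI _ (residuePart_mem h.pos _ hg₁)) _ fun β γ hγ hβ => ?_
  rw [coeff_residuePart, AddMonoidAlgebra.coeff_comapDomain, Finsupp.comapDomain_apply] at hγ
  rw [← add_assoc]
  refine dot_nonneg_of_coeff_toLaurent_ne_zero r g β _ ?_
  rwa [← hsum, coeff_add, hoff β hβ, add_zero]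

/-- Factoring out the monomial of least `ω`-order leaves `b`, whose residue is the lowest
coefficient of `a`. Thus nonzero elements of `K[x*]` lie in `residueSubmonoid`. -/
theorem exists_single_mul_toLaurent {ω : Fin N → ℝ} (hω : LinearIndependent ℚ ω)
    (r : Fin M → Fin N → ℤ) (c : Fin M → K) {a : Laurent K N} (ha : a ≠ 0) :
    ∃ (δ : Fin N → ℤ) (b : AddMonoidAlgebra K (nonnegCone ω)), residue hω c (C b) ≠ 0 ∧
      C a = C (AddMonoidAlgebra.single δ 1) * toLaurent K ω r (C b) := by
  classical
  have hne : a.coeff.support.Nonempty := Finsupp.support_nonempty_iff.2 fun h =>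
    ha (AddMonoidAlgebra.coeff_eq_zero.1 h)
  obtain ⟨δ, hδ, hmin⟩ := a.coeff.support.exists_min_image (dot ω) hne
  have hcone : ∀ α : a.coeff.support, (α : Fin N → ℤ) - δ ∈ nonnegCone ω := fun α => by
    change 0 ≤ dot ω (α - δ)
    rw [map_sub, sub_nonneg]
    exact hmin α α.2
  refine ⟨δ, ∑ α : a.coeff.support, AddMonoidAlgebra.single ⟨_, hcone α⟩ (a.coeff α), ?_, ?_⟩
  · rw [map_sum, map_sum, Finset.sum_eq_single ⟨δ, hδ⟩]
    · rw [← monomial_zero', residue_monomial, if_pos (Subtype.ext (sub_self δ))]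
      simpa using hδ
    · intro α _ hα
      rw [← monomial_zero', residue_monomial, if_neg, mul_zero]
      rw [Subtype.ext_iff]
      exact fun h => hα (Subtype.ext (sub_eq_zero.1 h))
    · simp
  · rw [map_sum, map_sum, Finset.mul_sum]
    have : ∀ α : a.coeff.support, C (AddMonoidAlgebra.single δ 1) * toLaurent K ω r
        (C (AddMonoidAlgebra.single ⟨_, hcone α⟩ (a.coeff α))) =
          C (AddMonoidAlgebra.single (α : Fin N → ℤ) (a.coeff α)) := fun α => by
      rw [← monomial_zero' (R := AddMonoidAlgebra K (nonnegCone ω)), toLaurent_monomial, map_zero,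
        sub_zero, monomial_zero', ← map_mul, AddMonoidAlgebra.single_mul_single, one_mul, add_sub_cancel]
    rw [Finset.sum_congr rfl fun α _ => this α, ← map_sum]
    congr 1
    rw [Finset.sum_coe_sort a.coeff.support fun α => AddMonoidAlgebra.single α (a.coeff α)]
    exact (AddMonoidAlgebra.sum_coeff_single a).symm

/-- The products of the monomials in `x` and the elements of nonnegative order with a nonzero
residue. -/
def residueSubmonoid {ω : Fin N → ℝ} (hω : LinearIndependent ℚ ω) (r : Fin M → Fin N → ℤ)
    (c : Fin M → K) : Submonoid (LaurentPoly K N M) where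
  carrier := {f | ∃ (δ : Fin N → ℤ) (g : NonnegPoly K ω M), residue hω c g ≠ 0 ∧
    f = C (AddMonoidAlgebra.single δ 1) * toLaurent K ω r g}
  one_mem' := ⟨0, 1, by simp, by
    rw [map_one, mul_one]
    rfl⟩
  mul_mem' := by
    rintro _ _ ⟨δ, g, hg, rfl⟩ ⟨δ', g', hg', rfl⟩
    refine ⟨δ + δ', g * g', by simp [hg, hg'], ?_⟩
    rw [map_mul, mul_mul_mul_comm, ← map_mul, AddMonoidAlgebra.single_mul_single, one_mul]

theorem exists_ringHom_isAlgClosed.{u} {A : Type u} [CommRing A] (P : Ideal A) [P.IsPrime] :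
    ∃ (L : Type u) (_ : Field L) (_ : IsAlgClosed L) (φ : A →+* L), ∀ f, φ f = 0 ↔ f ∈ P := by
  refine ⟨AlgebraicClosure (FractionRing (A ⧸ P)), inferInstance, inferInstance,
    ((algebraMap (FractionRing (A ⧸ P)) _).comp (algebraMap (A ⧸ P) (FractionRing (A ⧸ P)))).comp
      (Ideal.Quotient.mk P), fun f => ?_⟩
  simp only [RingHom.comp_apply, map_eq_zero, FaithfulSMul.algebraMap_eq_zero_iff,
    Ideal.Quotient.eq_zero_iff_mem]

/-- A point of `I` over an algebraically closed extension of `K[x*]`, centred at `c` with respect to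
a valuation ring. -/
theorem IsScaling.exists_valuationSubring.{u} {K : Type u} [Field K] {ω : Fin N → ℝ}
    (hω : LinearIndependent ℚ ω)
    {η : Fin M → WithTop ℝ} {d : ℕ} {r : Fin M → Fin N → ℤ} (h : IsScaling ω η d r)
    {c : Fin M → K} (hc : ∀ i, η i = ⊤ → c i = 0) {I : Ideal (LaurentPoly K N M)}
    (hI : ∀ f ∈ I, evalOne c (initialPart ω η f) = 0) :
    ∃ (L : Type u) (_ : Field L) (_ : IsAlgClosed L) (φ : LaurentPoly K N M →+* L)
      (V : ValuationSubring L), (∀ a, φ (C a) = 0 → a = 0) ∧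
      (∀ f ∈ extendedIdeal I η d, φ f = 0) ∧
      (∀ g, φ (toLaurent K ω r g) ∈ V) ∧
      ∀ g, residue hω c g = 0 → φ (toLaurent K ω r g) ∈ V.nonunits := by
  have hdisj : Disjoint (extendedIdeal I η d : Set (LaurentPoly K N M))
      (residueSubmonoid hω r c) := by
    rw [Set.disjoint_left]
    rintro _ hf ⟨δ, g, hg, rfl⟩
    refine hg (h.residue_eq_zero hω hc hI ?_)
    rwa [SetLike.mem_coe, Ideal.unit_mul_mem_iff_mem _ ((isUnit_single δ one_ne_zero).map C)] at hf
  obtain ⟨P, hP, hIP, hPd⟩ := Ideal.exists_le_prime_disjoint _ _ hdisj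
  obtain ⟨L, _, _, φ, hφ⟩ : ∃ (L : Type u) (_ : Field L) (_ : IsAlgClosed L)
      (φ : LaurentPoly K N M →+* L), ∀ f, φ f = 0 ↔ f ∈ P :=
    exists_ringHom_isAlgClosed P
  let ψ := (φ.comp (toLaurent K ω r)).rangeRestrict
  have hψ : Function.Surjective ψ := RingHom.rangeRestrict_surjective _
  -- If `1` were the image of some `g` of residue `0`, then `g - 1`, of residue `-1`, would map into
  -- the prime `P`, which avoids such elements.
  have hne : (RingHom.ker (residue hω c)).map ψ ≠ ⊤ := by
    rw [Ne, Ideal.eq_top_iff_one, Ideal.mem_map_iff_of_surjective ψ hψ]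
    rintro ⟨g, hg, hg1⟩
    have h1 : φ (toLaurent K ω r (g - 1)) = 0 := by
      rw [map_sub, map_sub, map_one, map_one, sub_eq_zero]
      exact congrArg Subtype.val hg1
    refine Set.disjoint_left.1 hPd ((hφ _).1 h1) ⟨0, g - 1, ?_, ?_⟩
    · rw [map_sub, map_one, (RingHom.mem_ker).1 hg]
      simp
    · exact (one_mul _).symm
  obtain ⟨V, hV, hV'⟩ := Ideal.image_subset_nonunits_valuationSubring _ hne
  refine ⟨L, inferInstance, inferInstance, φ, V, fun a ha => ?_, fun f hf => (hφ f).2 (hIP hf),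
    fun g => hV ⟨g, rfl⟩, fun g hg => hV' ⟨ψ g, Ideal.mem_map_of_mem _ hg, rfl⟩⟩
  by_contra h0
  obtain ⟨δ, b, hb, hab⟩ := exists_single_mul_toLaurent hω r c h0
  exact Set.disjoint_left.1 hPd ((hφ _).1 ha) ⟨δ, C b, hb, hab⟩

end Lift

/-! ### Values and residues of elements algebraic over `K[x*]`. -/

section Center

/-- The Newton polygon argument: in a vanishing sum the largest value cannot be attained by one term
alone. -/
theorem _root_.Valuation.exists_ne_map_coeff_mul_pow_eq {L Γ₀ : Type*} [Field L]
    [LinearOrderedCommGroupWithZero Γ₀] (v : Valuation L Γ₀) {p : Polynomial L} (hp : p ≠ 0)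
    {e : L} (he : p.eval e = 0) (he0 : e ≠ 0) :
    ∃ i ∈ p.support, ∃ j ∈ p.support, i < j ∧ v (p.coeff i * e ^ i) = v (p.coeff j * e ^ j) := by
  obtain ⟨i, hi, hmax⟩ := p.support.exists_max_image (fun i => v (p.coeff i * e ^ i))
    (Polynomial.support_nonempty.2 hp)
  by_contra! hne
  have hi0 : v (p.coeff i * e ^ i) ≠ 0 := by
    rw [Valuation.ne_zero_iff]
    exact mul_ne_zero (Polynomial.mem_support_iff.1 hi) (pow_ne_zero _ he0)
  have hlt : v (∑ j ∈ p.support.erase i, p.coeff j * e ^ j) < v (p.coeff i * e ^ i) := by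
    refine v.map_sum_lt hi0 fun j hj => ?_
    obtain ⟨hji, hj⟩ := Finset.mem_erase.1 hj
    refine lt_of_le_of_ne (hmax j hj) fun h => ?_
    rcases lt_or_gt_of_ne hji with h' | h'
    · exact hne j hj i hi h' h
    · exact hne i hi j hj h' h.symm
  rw [Polynomial.eval_eq_sum, Polynomial.sum_def, ← Finset.add_sum_erase _ _ hi,
    add_eq_zero_iff_eq_neg] at he
  rw [he, Valuation.map_neg] at hlt
  exact hlt.ne rfl

theorem _root_.Valuation.map_prod_sub_prod_lt {L Γ₀ ι : Type*} [CommRing L]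
    [LinearOrderedCommGroupWithZero Γ₀] (v : Valuation L Γ₀) (s : Finset ι) (x y : ι → L)
    (hx : ∀ i ∈ s, v (x i) ≤ 1) (hxy : ∀ i ∈ s, v (x i - y i) < 1) :
    v (∏ i ∈ s, x i - ∏ i ∈ s, y i) < 1 := by
  classical
  induction s using Finset.induction_on with
  | empty => simp
  | insert i s hi ih =>
    rw [Finset.prod_insert hi, Finset.prod_insert hi]
    have h1 := ih (fun j hj => hx j (Finset.mem_insert_of_mem hj))
      fun j hj => hxy j (Finset.mem_insert_of_mem hj)
    have h2 : v (∏ i ∈ s, y i) ≤ 1 := by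
      have : v (∏ i ∈ s, x i) ≤ 1 := by
        rw [map_prod]
        exact Finset.prod_le_one' fun j hj => hx j (Finset.mem_insert_of_mem hj)
      rw [← sub_sub_cancel (∏ i ∈ s, x i) (∏ i ∈ s, y i)]
      exact (v.map_sub _ _).trans (max_le this h1.le)
    have h3 : x i * ∏ i ∈ s, x i - y i * ∏ i ∈ s, y i =
        x i * (∏ i ∈ s, x i - ∏ i ∈ s, y i) + (x i - y i) * ∏ i ∈ s, y i := by ring
    rw [h3]
    refine v.map_add_lt ?_ ?_
    · rw [map_mul]
      exact mul_lt_one_of_nonneg_of_lt_one_right (hx i (Finset.mem_insert_self i s)) zero_le h1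
    · rw [map_mul]
      exact mul_lt_one_of_nonneg_of_lt_one_left zero_le (hxy i (Finset.mem_insert_self i s)) h2

theorem _root_.Valuation.map_pow_sub_pow_lt {L Γ₀ : Type*} [CommRing L]
    [LinearOrderedCommGroupWithZero Γ₀] (v : Valuation L Γ₀) {x y : L} (hx : v x ≤ 1)
    (hxy : v (x - y) < 1) (n : ℕ) : v (x ^ n - y ^ n) < 1 := by
  simpa using v.map_prod_sub_prod_lt (Finset.range n) (fun _ => x) (fun _ => y) (fun _ _ => hx)
    fun _ _ => hxy

variable {K : Type*} [Field K] {N M : ℕ} {L Γ₀ : Type*} [Field L]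
  [LinearOrderedCommGroupWithZero Γ₀]

/-- The valuation `v` of `L` extends the valuation of `K[x*]` given by the order with respect to
`ω`. -/
structure IsCentred (ω : Fin N → ℝ) (ψ : Laurent K N →+* L) (v : Valuation L Γ₀) : Prop where
  map_single_le_one : ∀ δ k, 0 ≤ dot ω δ → v (ψ (AddMonoidAlgebra.single δ k)) ≤ 1
  map_single_lt_one : ∀ δ k, 0 < dot ω δ → v (ψ (AddMonoidAlgebra.single δ k)) < 1

namespace IsCentred

variable {ω : Fin N → ℝ} {ψ : Laurent K N →+* L} {v : Valuation L Γ₀}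

theorem map_const (h : IsCentred ω ψ v) {k : K} (hk : k ≠ 0) :
    v (ψ (AddMonoidAlgebra.single 0 k)) = 1 := by
  have h1 := h.map_single_le_one 0 k (map_zero (dot ω)).ge
  have h2 := h.map_single_le_one 0 k⁻¹ (map_zero (dot ω)).ge
  have h3 : v (ψ (AddMonoidAlgebra.single 0 k)) * v (ψ (AddMonoidAlgebra.single 0 k⁻¹)) = 1 := by
    rw [← map_mul, ← map_mul, AddMonoidAlgebra.single_mul_single, mul_inv_cancel₀ hk, add_zero]
    exact (congrArg v (map_one ψ)).trans (map_one v)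
  refine le_antisymm h1 (le_of_not_gt fun hlt => ?_)
  exact (mul_lt_one_of_nonneg_of_lt_one_left zero_le hlt h2).ne h3

theorem map_single_mul_map_single_neg (ψ : Laurent K N →+* L) (δ : Fin N → ℤ) :
    ψ (AddMonoidAlgebra.single δ 1) * ψ (AddMonoidAlgebra.single (-δ) 1) = 1 := by
  rw [← map_mul, AddMonoidAlgebra.single_mul_single, add_neg_cancel, one_mul]
  exact map_one ψ

theorem dot_pos (h : IsCentred ω ψ v) {δ : Fin N → ℤ}
    (hδ : v (ψ (AddMonoidAlgebra.single δ 1)) < 1) : 0 < dot ω δ := by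
  by_contra! hle
  have h1 := h.map_single_le_one (-δ) 1 (by rw [map_neg]; linarith)
  have h2 := congrArg v (map_single_mul_map_single_neg ψ δ)
  rw [map_mul, map_one] at h2
  exact (mul_lt_one_of_nonneg_of_lt_one_left zero_le hδ h1).ne h2

theorem map_sub_const_lt (hω : LinearIndependent ℚ ω) (h : IsCentred ω ψ v) {a : Laurent K N}
    (ha : ∀ α, a.coeff α ≠ 0 → 0 ≤ dot ω α) :
    v (ψ a - ψ (AddMonoidAlgebra.single 0 (a.coeff 0))) < 1 := by
  classical
  have h1 : a - AddMonoidAlgebra.single 0 (a.coeff 0) =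
      ∑ α ∈ a.coeff.support.erase 0, AddMonoidAlgebra.single α (a.coeff α) := by
    rw [sub_eq_iff_eq_add']
    conv_lhs => rw [← AddMonoidAlgebra.sum_coeff_single a]
    by_cases h0 : 0 ∈ a.coeff.support
    · exact (Finset.add_sum_erase _ _ h0).symm
    · rw [Finset.erase_eq_of_notMem h0, Finsupp.notMem_support_iff.1 h0,
        AddMonoidAlgebra.single_zero, zero_add]
      rfl
  rw [← map_sub, h1, map_sum]
  refine v.map_sum_lt one_ne_zero fun α hα => h.map_single_lt_one _ _ ?_
  obtain ⟨hα0, hα⟩ := Finset.mem_erase.1 hα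
  refine lt_of_le_of_ne (ha α (Finsupp.mem_support_iff.1 hα)) fun h0 => hα0 ?_
  exact dot_injective hω (h0.symm.trans (map_zero _).symm)

theorem coeff_single_neg_mul (δ α : Fin N → ℤ) (a : Laurent K N) :
    (AddMonoidAlgebra.single (-δ) 1 * a).coeff α = a.coeff (α + δ) := by
  rw [AddMonoidAlgebra.coeff_single_mul_eq_mul_coeff (m₂ := α + δ), one_mul]
  intro γ _
  rw [neg_add_eq_iff_eq_add, add_comm]

/-- After division by its monomial of least `ω`-order, `a` is a nonzero constant plus an element of
value less than `1`. -/
theorem exists_map_eq (hω : LinearIndependent ℚ ω) (h : IsCentred ω ψ v) {a : Laurent K N}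
    (ha : a ≠ 0) : ∃ δ, v (ψ a) = v (ψ (AddMonoidAlgebra.single δ 1)) := by
  have hne : a.coeff.support.Nonempty := Finsupp.support_nonempty_iff.2 fun h =>
    ha (AddMonoidAlgebra.coeff_eq_zero.1 h)
  obtain ⟨δ, hδ, hmin⟩ := a.coeff.support.exists_min_image (dot ω) hne
  refine ⟨δ, ?_⟩
  have h1 := h.map_sub_const_lt hω (a := AddMonoidAlgebra.single (-δ) 1 * a) fun α hα => by
    rw [coeff_single_neg_mul] at hα
    have := hmin _ (Finsupp.mem_support_iff.2 hα)
    rw [map_add] at this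
    linarith
  rw [coeff_single_neg_mul, zero_add] at h1
  have h2 := h.map_const (Finsupp.mem_support_iff.1 hδ)
  have h3 : v (ψ (AddMonoidAlgebra.single (-δ) 1 * a)) = 1 := by
    rw [← h2] at h1 ⊢
    exact Valuation.map_eq_of_sub_lt v h1
  rw [map_mul, map_mul] at h3
  have h4 := congrArg v (map_single_mul_map_single_neg ψ δ)
  rw [map_mul, map_one] at h4
  calc v (ψ a) = v (ψ (AddMonoidAlgebra.single δ 1)) * v (ψ (AddMonoidAlgebra.single (-δ) 1))
        * v (ψ a) := by rw [h4, one_mul]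
    _ = _ := by rw [mul_assoc, h3, mul_one]

theorem exists_pow_eq (hω : LinearIndependent ℚ ω) (h : IsCentred ω ψ v)
    (hψ : Function.Injective ψ) {p : Polynomial (Laurent K N)} (hp : p ≠ 0) {e : L}
    (he : p.eval₂ ψ e = 0) (he0 : e ≠ 0) :
    ∃ n : ℕ, 0 < n ∧ ∃ γ, v e ^ n = v (ψ (AddMonoidAlgebra.single γ 1)) := by
  obtain ⟨i, hi, j, hj, hij, heq⟩ := v.exists_ne_map_coeff_mul_pow_eq
    ((Polynomial.map_ne_zero_iff hψ).2 hp) (by rwa [Polynomial.eval_map]) he0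
  rw [Polynomial.mem_support_iff, Polynomial.coeff_map, map_ne_zero_iff ψ hψ] at hi hj
  obtain ⟨δ, hδ⟩ := h.exists_map_eq hω hi
  obtain ⟨δ', hδ'⟩ := h.exists_map_eq hω hj
  refine ⟨j - i, Nat.sub_pos_of_lt hij, δ - δ', ?_⟩
  rw [Polynomial.coeff_map, Polynomial.coeff_map, map_mul, map_mul, hδ, hδ', map_pow, map_pow,
    ← Nat.sub_add_cancel hij.le, pow_add, ← mul_assoc] at heq
  have h1 := mul_right_cancel₀ (pow_ne_zero _ (v.ne_zero_iff.2 he0)) heq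
  have h2 : AddMonoidAlgebra.single (δ - δ') (1 : K) =
      AddMonoidAlgebra.single δ 1 * AddMonoidAlgebra.single (-δ') 1 := by
    rw [AddMonoidAlgebra.single_mul_single, one_mul, sub_eq_add_neg]
  have h3 := congrArg v (map_single_mul_map_single_neg ψ δ')
  rw [map_mul, map_one] at h3
  rw [h2, map_mul, map_mul, h1, mul_right_comm, h3, one_mul]

theorem exists_residue [IsAlgClosed K] (hω : LinearIndependent ℚ ω) (h : IsCentred ω ψ v)
    {p : Polynomial (Laurent K N)} (hp : p ≠ 0) {τ : L}
    (hτ : p.eval₂ ψ τ = 0) (hτ1 : v τ = 1) :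
    ∃ k : K, k ≠ 0 ∧ v (τ - ψ (AddMonoidAlgebra.single 0 k)) < 1 := by
  classical
  let s := p.support.biUnion fun i => (p.coeff i).coeff.support
  have hs : ∀ i α, (p.coeff i).coeff α ≠ 0 → α ∈ s := fun i α hα =>
    Finset.mem_biUnion.2 ⟨i, Polynomial.mem_support_iff.2 fun h0 => hα (by rw [h0]; rfl),
      Finsupp.mem_support_iff.2 hα⟩
  have hne : s.Nonempty := by
    have h1 : p.leadingCoeff.coeff.support.Nonempty := Finsupp.support_nonempty_iff.2 fun h =>
      Polynomial.leadingCoeff_ne_zero.2 hp (AddMonoidAlgebra.coeff_eq_zero.1 h)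
    obtain ⟨α, hα⟩ := h1
    exact ⟨α, hs _ α (Finsupp.mem_support_iff.1 hα)⟩
  obtain ⟨δ, hδ, hmin⟩ := s.exists_min_image (dot ω) hne
  -- `q` is the reduction of `x^{-δ} p`, with `δ` of least `ω`-order among all exponents in `p`;
  -- hence `q` is nonzero and `q(τ)` has value less than `1`.
  let q : Polynomial K := ∑ i ∈ p.support, Polynomial.monomial i ((p.coeff i).coeff δ)
  have hq : q ≠ 0 := by
    obtain ⟨i, hi, hiδ⟩ := Finset.mem_biUnion.1 hδ
    intro h0
    have := congrArg (fun q => Polynomial.coeff q i) h0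
    simp only [q, Polynomial.finsetSum_coeff, Polynomial.coeff_monomial, Finset.sum_ite_eq',
      if_pos hi, Polynomial.coeff_zero] at this
    exact Finsupp.mem_support_iff.1 hiδ this
  let κ : K →+* L := ψ.comp AddMonoidAlgebra.singleZeroRingHom
  have hκ : ∀ k, κ k = ψ (AddMonoidAlgebra.single 0 k) := fun _ => rfl
  have h1 : v (q.eval₂ κ τ) < 1 := by
    have h2 : ψ (AddMonoidAlgebra.single (-δ) 1) * p.eval₂ ψ τ - q.eval₂ κ τ =
        ∑ i ∈ p.support, (ψ (AddMonoidAlgebra.single (-δ) 1 * p.coeff i) -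
          ψ (AddMonoidAlgebra.single 0 ((AddMonoidAlgebra.single (-δ) 1 * p.coeff i).coeff 0))) *
            τ ^ i := by
      rw [Polynomial.eval₂_eq_sum, Polynomial.sum_def, Finset.mul_sum]
      simp only [q, Polynomial.eval₂_finsetSum, Polynomial.eval₂_monomial]
      rw [← Finset.sum_sub_distrib]
      refine Finset.sum_congr rfl fun i _ => ?_
      rw [coeff_single_neg_mul, zero_add, hκ, map_mul]
      ring
    rw [hτ, mul_zero, zero_sub] at h2
    rw [← Valuation.map_neg, h2]
    refine v.map_sum_lt one_ne_zero fun i _ => ?_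
    rw [map_mul, map_pow, hτ1, one_pow, mul_one]
    refine h.map_sub_const_lt hω fun α hα => ?_
    rw [coeff_single_neg_mul] at hα
    have := hmin _ (hs i _ hα)
    rw [map_add] at this
    linarith
  rw [(IsAlgClosed.splits q).eq_prod_roots, Polynomial.eval₂_mul, Polynomial.eval₂_C,
    ← Polynomial.coe_eval₂RingHom, map_multiset_prod, map_mul, hκ,
    h.map_const (Polynomial.leadingCoeff_ne_zero.2 hq), one_mul, map_multiset_prod,
    Multiset.map_map, Multiset.map_map] at h1
  -- `q` splits over `K`, so some factor of `q(τ)` has value less than `1`, and its root is the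
  -- residue of `τ`.
  obtain ⟨k, -, hk⟩ : ∃ k ∈ q.roots, v (τ - κ k) < 1 := by
    by_contra! hall
    refine h1.not_ge (Multiset.one_le_prod fun x hx => ?_)
    obtain ⟨k, hk, rfl⟩ := Multiset.mem_map.1 hx
    simpa using hall k hk
  refine ⟨k, ?_, hk⟩
  rintro rfl
  rw [map_zero, sub_zero, hτ1] at hk
  exact lt_irrefl _ hk

end IsCentred

end Center

/-! ### From an algebraic point to an `ω`-set. -/

section Construction

open MvPolynomial

variable {K : Type*} [Field K] {N M : ℕ}

theorem isStarting_of_evalOne_initialPart {ω : Fin N → ℝ} {I : Ideal (LaurentPoly K N M)}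
    {D : OmegaSet K M ω} (h : ∀ f ∈ I, evalOne D.c (initialPart ω D.η f) = 0) :
    IsStarting I D := by
  have h1 : ∀ f ∈ initialIdeal ω D.η I, evalOne D.c f = 0 := by
    have : initialIdeal ω D.η I ≤ RingHom.ker (evalOne (N := N) D.c) := by
      refine Ideal.span_le.2 ?_
      rintro _ (⟨f, hf, rfl⟩ | ⟨i, hi, rfl⟩)
      · exact h f hf
      · simp [evalOne, RingHom.mem_ker, D.c_eq_zero i hi]
    exact fun f hf => this hf
  refine ⟨fun a α β ha hβ hmem => ?_, h1⟩
  have h2 := h1 _ hmem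
  rw [evalOne_monomial] at h2
  refine mul_ne_zero ha (Finset.prod_ne_zero_iff.2 fun i _ => ?_) h2
  by_cases hi : D.η i = ⊤
  · simp [hβ i hi]
  · exact pow_ne_zero _ (D.c_ne_zero i hi)

theorem eq_sum_monomial_single (f : LaurentPoly K N M) :
    f = ∑ β ∈ f.support, ∑ α ∈ (f.coeff β).coeff.support,
      monomial β (AddMonoidAlgebra.single α ((f.coeff β).coeff α)) := by
  conv_lhs => rw [f.as_sum]
  refine Finset.sum_congr rfl fun β _ => ?_
  rw [← map_sum]
  exact congrArg _ (AddMonoidAlgebra.sum_coeff_single _).symm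

variable {L Γ₀ : Type*} [Field L] [LinearOrderedCommGroupWithZero Γ₀]

/-- Choosing a `d`-th root of each `x_j` gives compatible meanings `ξ(ε) = x^{ε/d}` to all
fractional monomials. -/
theorem exists_root_hom [IsAlgClosed L] (ψ : Laurent K N →+* L) {d : ℕ} (hd : 0 < d) :
    ∃ ξ : Multiplicative (Fin N → ℤ) →* L,
      ∀ α, ξ (.ofAdd (d • α)) = ψ (AddMonoidAlgebra.single α 1) := by
  let U : Multiplicative (Fin N → ℤ) →* Lˣ :=
    ((ψ : Laurent K N →* L).comp (AddMonoidAlgebra.of K (Fin N → ℤ))).toHomUnits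
  have hU : ∀ α, ((U (.ofAdd α) : Lˣ) : L) = ψ (AddMonoidAlgebra.single α 1) := fun _ => rfl
  have hroot : ∀ j : Fin N, ∃ u : Lˣ, u ^ d = U (.ofAdd (Pi.single j 1)) := fun j => by
    obtain ⟨y, hy⟩ := IsAlgClosed.exists_pow_nat_eq
      ((U (.ofAdd (Pi.single j 1)) : Lˣ) : L) hd
    have hy0 : y ≠ 0 := by
      rintro rfl
      rw [zero_pow hd.ne'] at hy
      exact (Units.ne_zero _) hy.symm
    exact ⟨Units.mk0 y hy0, Units.ext hy⟩
  choose u hu using hroot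
  let ξ : Multiplicative (Fin N → ℤ) →* Lˣ :=
    { toFun := fun α => ∏ j, u j ^ (α.toAdd j)
      map_one' := by simp
      map_mul' := fun α β => by simp [zpow_add, Finset.prod_mul_distrib] }
  refine ⟨(Units.coeHom L).comp ξ, fun α => ?_⟩
  rw [← hU]
  refine congrArg Units.val ?_
  have h1 : (Multiplicative.ofAdd α) = ∏ j, (Multiplicative.ofAdd (Pi.single j (1 : ℤ))) ^ α j := by
    refine Multiplicative.toAdd.injective ?_
    rw [toAdd_prod]
    ext j
    simp [Finset.sum_apply, Pi.single_apply]
  conv_rhs => rw [h1]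
  rw [map_prod]
  change ∏ j, u j ^ ((d • α) j) = _
  refine Finset.prod_congr rfl fun j _ => ?_
  rw [map_zpow, ← hu, ← zpow_natCast, ← zpow_mul]
  simp

/-- If `f` vanishes at the point with the coordinates `z_i = x^{r_i / d} τ_i`, then its initial part
vanishes at `(1, c)`, where `c_i` is the residue of `τ_i`. -/
theorem IsCentred.evalOne_initialPart_eq_zero {ω : Fin N → ℝ} (hω : LinearIndependent ℚ ω)
    {ψ : Laurent K N →+* L} {v : Valuation L Γ₀} (h : IsCentred ω ψ v)
    {η : Fin M → WithTop ℝ} {d : ℕ} {r : Fin M → Fin N → ℤ} (hs : IsScaling ω η d r)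
    (ξ : Multiplicative (Fin N → ℤ) →* L)
    (hξ : ∀ α, ξ (.ofAdd (d • α)) = ψ (AddMonoidAlgebra.single α 1)) {z τ : Fin M → L}
    {c : Fin M → K} (hz0 : ∀ i, η i = ⊤ → z i = 0)
    (hz : ∀ i, η i ≠ ⊤ → z i = ξ (.ofAdd (r i)) * τ i) (hτ : ∀ i, η i ≠ ⊤ → v (τ i) ≤ 1)
    (hτc : ∀ i, η i ≠ ⊤ → v (τ i - ψ (AddMonoidAlgebra.single 0 (c i))) < 1)
    {f : LaurentPoly K N M} (hf : f.eval₂ ψ z = 0) :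
    evalOne c (initialPart ω η f) = 0 := by
  classical
  by_cases htop : polyOrder ω η f = ⊤
  · rw [initialPart, if_pos htop, map_zero]
  have hd : (0 : ℝ) < d := by exact_mod_cast hs.pos
  obtain ⟨β₀, α₀, h0, hw⟩ := exists_weight_eq_polyOrder ω η f htop
  have hβ₀ : ∀ i, η i = ⊤ → β₀ i = 0 := by
    by_contra hβ
    exact htop (hw ▸ weight_eq_top α₀ hβ)
  -- The factor `x^{κ/d}` moves the least weight of `f` to `0`.
  let κ := -(d • α₀ + shift r β₀)
  have hκ : polyOrder ω η f = ((-dot ω κ / d : ℝ) : WithTop ℝ) := by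
    rw [← hw, ← hs.add_eq_zero_iff hω κ α₀ hβ₀, neg_add_cancel]
  rw [hs.evalOne_initialPart_eq_functional hω c hκ]
  let ρ : K →+* L := ψ.comp AddMonoidAlgebra.singleZeroRingHom
  have hρ : ∀ k, ρ k = ψ (AddMonoidAlgebra.single 0 k) := fun _ => rfl
  have hρ1 : ∀ k, v (ρ k) ≤ 1 := fun k => h.map_single_le_one 0 k (map_zero (dot ω)).ge
  have hξ1 : ∀ ε, 0 < dot ω ε → v (ξ (.ofAdd ε)) < 1 := fun ε hε => by
    refine lt_of_not_ge fun hge => ?_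
    have h1 := h.map_single_lt_one ε 1 hε
    rw [← hξ, ofAdd_nsmul, map_pow, map_pow] at h1
    exact h1.not_ge (one_le_pow_of_one_le' hge d)
  have hterm : ∀ β α, (f.coeff β).coeff α ≠ 0 → v (ξ (.ofAdd κ) * (monomial β
      (AddMonoidAlgebra.single α ((f.coeff β).coeff α)) : LaurentPoly K N M).eval₂ ψ z -
        ρ ((f.coeff β).coeff α * slice η c d r κ β α)) < 1 := by
    intro β α hαβ
    have hle := polyOrder_le ω η f hαβ
    generalize (f.coeff β).coeff α = k at *
    rw [eval₂_monomial, Finsupp.prod_fintype _ _ (by simp)]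
    by_cases hβ : ∀ i, η i = ⊤ → β i = 0
    · have h1 : ψ (AddMonoidAlgebra.single α k) = ρ k * ξ (.ofAdd (d • α)) := by
        rw [hρ, hξ, ← map_mul, AddMonoidAlgebra.single_mul_single, zero_add, mul_one]
      have h2 : ∏ i, z i ^ β i = ξ (.ofAdd (shift r β)) * ∏ i, τ i ^ β i := by
        rw [shift_apply, ofAdd_sum, map_prod, ← Finset.prod_mul_distrib]
        refine Finset.prod_congr rfl fun i _ => ?_
        by_cases hi : η i = ⊤
        · simp [hβ i hi]
        · rw [hz i hi, mul_pow, ofAdd_nsmul, map_pow]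
      have h3 : ξ (.ofAdd κ) * (ψ (AddMonoidAlgebra.single α k) * ∏ i, z i ^ β i) =
          ρ k * (ξ (.ofAdd (κ + (d • α + shift r β))) * ∏ i, τ i ^ β i) := by
        rw [h1, h2, ofAdd_add, ofAdd_add, map_mul, map_mul]
        ring
      have hτi : ∀ i ∈ Finset.univ, v (τ i ^ β i) ≤ 1 := fun i _ => by
        by_cases hi : η i = ⊤
        · simp [hβ i hi]
        · rw [map_pow]
          exact pow_le_one' (hτ i hi) _
      have hτ' : v (∏ i, τ i ^ β i) ≤ 1 := by
        rw [map_prod]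
        exact Finset.prod_le_one' hτi
      rw [h3]
      by_cases hε : κ + (d • α + shift r β) = 0
      · rw [slice, if_pos ⟨hβ, hε⟩, hε, ofAdd_zero, map_one, one_mul, map_mul, ← mul_sub, map_mul,
          map_prod]
        refine mul_lt_one_of_nonneg_of_lt_one_right (hρ1 k) zero_le ?_
        refine v.map_prod_sub_prod_lt _ _ _ hτi fun i _ => ?_
        by_cases hi : η i = ⊤
        · simp [hβ i hi]
        · rw [map_pow]
          exact v.map_pow_sub_pow_lt (hτ i hi) (hτc i hi) _
      · rw [slice, if_neg fun h => hε h.2, mul_zero, map_zero, sub_zero, map_mul, map_mul]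
        refine mul_lt_one_of_nonneg_of_lt_one_right (hρ1 k) zero_le ?_
        refine mul_lt_one_of_nonneg_of_lt_one_left zero_le (hξ1 _ ?_) hτ'
        rw [hκ, hs.weight_eq α hβ, WithTop.coe_le_coe, div_le_div_iff_of_pos_right hd] at hle
        refine lt_of_le_of_ne ?_ fun h => hε ((dot_injective hω) (h.symm.trans (map_zero _).symm))
        rw [map_add]
        linarith
    · rw [slice, if_neg fun h => hβ h.1]
      push Not at hβ
      obtain ⟨i, hi, hβi⟩ := hβ
      rw [Finset.prod_eq_zero (Finset.mem_univ i) (by rw [hz0 i hi, zero_pow hβi])]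
      simp
  -- Termwise, `x^{κ/d} f(z)` agrees with the value of the initial part up to elements of value less
  -- than `1`. As `f(z) = 0`, that value is a constant of `K` with value less than `1`, hence `0`.
  have hlt : v (ρ (functional (slice η c d r κ) f)) < 1 := by
    have h1 : -ρ (functional (slice η c d r κ) f) =
        ξ (.ofAdd κ) * f.eval₂ ψ z - ρ (functional (slice η c d r κ) f) := by
      rw [hf, mul_zero, zero_sub]
    have h2 : f.eval₂ ψ z = ∑ β ∈ f.support, ∑ α ∈ (f.coeff β).coeff.support,
        (monomial β (AddMonoidAlgebra.single α ((f.coeff β).coeff α)) :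
          LaurentPoly K N M).eval₂ ψ z := by
      conv_lhs => rw [eq_sum_monomial_single f]
      simp only [eval₂_sum]
    rw [← Valuation.map_neg, h1, h2, functional_apply, map_sum, Finset.mul_sum,
      ← Finset.sum_sub_distrib]
    refine v.map_sum_lt one_ne_zero fun β _ => ?_
    rw [map_sum, Finset.mul_sum, ← Finset.sum_sub_distrib]
    exact v.map_sum_lt one_ne_zero fun α hα => hterm β α (Finsupp.mem_support_iff.1 hα)
  by_contra hne
  exact hlt.ne (h.map_const hne)

theorem exists_eval₂_eq_zero_mul {R L : Type*} [CommRing R] [IsDomain R] [Field L] {ψ : R →+* L}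
    (hψ : Function.Injective ψ) {x y : L} {n : ℕ} (hn : 0 < n)
    (hx : ∃ p : Polynomial R, p ≠ 0 ∧ p.eval₂ ψ x = 0) (hy : ∃ a, y ^ n = ψ a) :
    ∃ p : Polynomial R, p ≠ 0 ∧ p.eval₂ ψ (x * y) = 0 := by
  algebraize [ψ]
  have : FaithfulSMul R L := (faithfulSMul_iff_algebraMap_injective R L).2 hψ
  obtain ⟨a, ha⟩ := hy
  have h1 : IsAlgebraic R x := hx
  have h2 : IsAlgebraic R y := IsAlgebraic.of_pow hn (ha ▸ isAlgebraic_algebraMap a)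
  exact h1.mul h2

/-- The leading terms of an algebraic point form an `ω`-set at which the initial part of every
polynomial vanishing at the point is zero. -/
theorem IsCentred.exists_omegaSet [IsAlgClosed K] [IsAlgClosed L] {ω : Fin N → ℝ}
    (hω : LinearIndependent ℚ ω) {ψ : Laurent K N →+* L} (hψ : Function.Injective ψ)
    {v : Valuation L Γ₀} (h : IsCentred ω ψ v) {z : Fin M → L}
    (hz : ∀ i, ∃ p : Polynomial (Laurent K N), p ≠ 0 ∧ p.eval₂ ψ (z i) = 0) :
    ∃ D : OmegaSet K M ω, (∀ f : LaurentPoly K N M, f.eval₂ ψ z = 0 →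
      evalOne D.c (initialPart ω D.η f) = 0) ∧
      ∀ i, D.η i ≠ ⊤ → z i ≠ 0 ∧ ∃ n : ℕ, 0 < n ∧ ∃ γ,
        v (z i) ^ n = v (ψ (AddMonoidAlgebra.single γ 1)) ∧
        D.η i = ((dot ω γ / n : ℝ) : WithTop ℝ) := by
  classical
  have : IsDomain (Laurent K N) := hψ.isDomain
  have hval : ∀ i, ∃ (n : ℕ) (γ : Fin N → ℤ), 0 < n ∧
      (z i ≠ 0 → v (z i) ^ n = v (ψ (AddMonoidAlgebra.single γ 1))) := fun i => by
    by_cases hi : z i = 0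
    · exact ⟨1, 0, one_pos, fun h => absurd hi h⟩
    · obtain ⟨p, hp, hp0⟩ := hz i
      obtain ⟨n, hn, γ, hγ⟩ := h.exists_pow_eq hω hψ hp hp0 hi
      exact ⟨n, γ, hn, fun _ => hγ⟩
  choose n γ hn hγ using hval
  let Γ : Matrix (Fin M) (Fin N) (WithTop ℚ) := fun i j =>
    if z i = 0 then ⊤ else ((γ i j / n i : ℚ) : WithTop ℚ)
  let η : Fin M → WithTop ℝ := fun i => if z i = 0 then ⊤ else ((dot ω (γ i) / n i : ℝ) : WithTop ℝ)
  have hη : ∀ i, η i = ⊤ ↔ z i = 0 := fun i => by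
    by_cases hi : z i = 0 <;> simp [η, hi]
  obtain ⟨ξ, hξ⟩ := exists_root_hom ψ (denom_pos Γ)
  have hr : ∀ i, z i ≠ 0 → n i • scaledRow Γ i = denom Γ • γ i := fun i hi => by
    ext j
    have h1 := scaledRow_cast Γ i j
    have h2 : (n i : ℚ) ≠ 0 := by exact_mod_cast (hn i).ne'
    have h3 : (Γ i j).untopD 0 = (γ i j / n i : ℚ) := by
      simp only [Γ, if_neg hi, WithTop.untopD_coe]
    rw [h3, mul_div_assoc', eq_div_iff h2] at h1
    clear_value Γ
    simp only [Pi.smul_apply, nsmul_eq_mul]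
    rw [mul_comm]
    exact_mod_cast h1
  -- `τ_i` is `z_i` divided by its leading monomial `x^{γ_i/n_i}`; when `z_i ≠ 0` it has value `1`,
  -- and its residue is the coefficient `c_i`.
  let τ : Fin M → L := fun i => z i * ξ (.ofAdd (-scaledRow Γ i))
  have hξn : ∀ i, z i ≠ 0 → ξ (.ofAdd (-scaledRow Γ i)) ^ n i =
      ψ (AddMonoidAlgebra.single (-γ i) 1) := fun i hi => by
    rw [← map_pow, ← ofAdd_nsmul, smul_neg, hr i hi, ← smul_neg, hξ]
  have hτ1 : ∀ i, z i ≠ 0 → v (τ i) = 1 := fun i hi => by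
    refine (pow_eq_one_iff.1 ?_).resolve_right (hn i).ne'
    rw [map_mul, mul_pow, hγ i hi, ← map_pow, hξn i hi, ← map_mul,
      IsCentred.map_single_mul_map_single_neg, map_one]
  have hres : ∀ i, ∃ k : K, if z i = 0 then k = 0 else
      k ≠ 0 ∧ v (τ i - ψ (AddMonoidAlgebra.single 0 k)) < 1 := fun i => by
    by_cases hi : z i = 0
    · exact ⟨0, by rw [if_pos hi]⟩
    · obtain ⟨p, hp, hp0⟩ := exists_eval₂_eq_zero_mul hψ (hn i) (hz i) ⟨_, hξn i hi⟩
      obtain ⟨k, hk⟩ := h.exists_residue hω hp hp0 (hτ1 i hi)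
      exact ⟨k, by rwa [if_neg hi]⟩
  choose c hc using hres
  let D : OmegaSet K M ω :=
    { η := η
      Γ := Γ
      c := c
      dot_eq := fun i hi => by
        have hi' : z i ≠ 0 := fun h => hi ((hη i).2 h)
        simp only [Γ, η, if_neg hi', WithTop.map_coe]
        rw [dot, AddMonoidHom.coe_mk, ZeroHom.coe_mk, Finset.sum_div, WithTop.coe_sum]
        refine Finset.sum_congr rfl fun j _ => ?_
        rw [← WithTop.coe_mul, mul_div_assoc]
        push_cast
        rfl
      row_eq_top := fun i hi j => by simp only [Γ, if_pos ((hη i).1 hi)]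
      c_ne_zero := fun i hi => by
        have := hc i
        rw [if_neg fun h => hi ((hη i).2 h)] at this
        exact this.1
      c_eq_zero := fun i hi => by
        have := hc i
        rwa [if_pos ((hη i).1 hi)] at this }
  refine ⟨D, fun f hf => ?_, fun i hi => ?_⟩
  · refine h.evalOne_initialPart_eq_zero hω (D.isScaling hω) ξ hξ (τ := τ)
      (fun i hi => (hη i).1 hi) (fun i hi => ?_)
      (fun i hi => (hτ1 i fun h => hi ((hη i).2 h)).le) (fun i hi => ?_) hf
    · change z i = ξ (.ofAdd (scaledRow Γ i)) * (z i * ξ (.ofAdd (-scaledRow Γ i)))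
      rw [mul_left_comm, ← map_mul, ← ofAdd_add, add_neg_cancel, ofAdd_zero, map_one, mul_one]
    · have := hc i
      rw [if_neg fun h => hi ((hη i).2 h)] at this
      exact this.2
  · have hi' : z i ≠ 0 := fun h => hi ((hη i).2 h)
    exact ⟨hi', n i, hn i, γ i, hγ i hi', if_neg hi'⟩

end Construction

/-! ### The inductive step and the infinite sequence. -/

section Main

open MvPolynomial

variable {K : Type*} [Field K] {N M : ℕ} {ω : Fin N → ℝ}

theorem IsStarting.evalOne_initialPart {I : Ideal (LaurentPoly K N M)} {D : OmegaSet K M ω}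
    (h : IsStarting I D) : ∀ f ∈ I, evalOne D.c (initialPart ω D.η f) = 0 :=
  fun f hf => h.2 _ (Ideal.subset_span (Or.inl ⟨f, hf, rfl⟩))

/-- Subtracting `c_i x^{r_i}` from the coordinates undoes the shift in `substitution` and leaves
`f(x^d, y)`, which `φ` kills. -/
theorem transform_le_ker {L : Type*} [Field L] {I : Ideal (LaurentPoly K N M)}
    {D : OmegaSet K M ω} {φ : LaurentPoly K N M →+* L}
    (hφ : ∀ f ∈ extendedIdeal I D.η (denom D.Γ), φ f = 0) :
    transform I D ≤ RingHom.ker (eval₂Hom (φ.comp C) fun i =>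
      φ (X i) - φ (C (AddMonoidAlgebra.single (scaledRow D.Γ i) (D.c i)))) := by
  refine Ideal.span_le.2 ?_
  rintro _ ⟨f, hf, rfl⟩
  rw [SetLike.mem_coe, RingHom.mem_ker, ← RingHom.comp_apply]
  have h1 : (eval₂Hom (φ.comp C) fun i =>
      φ (X i) - φ (C (AddMonoidAlgebra.single (scaledRow D.Γ i) (D.c i)))).comp
        (substitution D) = φ.comp (MvPolynomial.map (power K N (denom D.Γ))) := by
    refine MvPolynomial.ringHom_ext (fun a => ?_) fun i => ?_
    · simp [substitution, power]
    · simp [substitution]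
  rw [h1, RingHom.comp_apply]
  exact hφ _ (Ideal.mem_sup_left (Ideal.mem_map_of_mem _ hf))

theorem IsStarting.transform_inf_eq_bot_and_exists [IsAlgClosed K] (hω : LinearIndependent ℚ ω)
    {I : Ideal (LaurentPoly K N M)} (hI : IsAlgebraicMod I) {D : OmegaSet K M ω}
    (hD : IsStarting I D) :
    (∀ a : Laurent K N, C a ∈ transform I D → a = 0) ∧
    ∃ D' : OmegaSet K M ω, IsStarting (transform I D) D' ∧ Exceeds D D' := by
  have hs := D.isScaling hω
  obtain ⟨L, _, _, φ, V, hinj, hφ, hV, hV'⟩ :=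
    hs.exists_valuationSubring hω D.c_eq_zero hD.evalOne_initialPart
  have hker := transform_le_ker hφ
  set z : Fin M → L := fun i =>
    φ (X i) - φ (C (AddMonoidAlgebra.single (scaledRow D.Γ i) (D.c i))) with hz
  have hψ : Function.Injective (φ.comp C) := (injective_iff_map_eq_zero _).2 hinj
  have hlau : ∀ δ (hδ : 0 ≤ dot ω δ) (k : K), toLaurent K ω (scaledRow D.Γ)
      (monomial 0 (AddMonoidAlgebra.single ⟨δ, hδ⟩ k)) = C (AddMonoidAlgebra.single δ k) := by
    intro δ hδ k
    rw [toLaurent_monomial, map_zero, sub_zero]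
    rfl
  have hcen : IsCentred ω (φ.comp C) V.valuation := by
    refine ⟨fun δ k hδ => ?_, fun δ k hδ => ?_⟩
    · rw [ValuationSubring.valuation_le_one_iff, RingHom.comp_apply, ← hlau δ hδ]
      exact hV _
    · rw [← ValuationSubring.mem_nonunits_iff, RingHom.comp_apply, ← hlau δ hδ.le]
      refine hV' _ ?_
      rw [residue_monomial, if_neg, mul_zero]
      intro h0
      have h1 : δ = 0 := congrArg Subtype.val h0
      rw [h1] at hδ
      exact hδ.ne' (map_zero _)
  refine ⟨fun a ha => ?_, ?_⟩
  · have := hker ha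
    rw [RingHom.mem_ker, coe_eval₂Hom, eval₂_C] at this
    exact hinj a this
  have hzalg : ∀ i, ∃ p : Polynomial (Laurent K N), p ≠ 0 ∧ p.eval₂ (φ.comp C) (z i) = 0 := by
    intro i
    obtain ⟨p, hp0, hp⟩ := hI.transform D i
    refine ⟨p, hp0, ?_⟩
    have := hker hp
    rw [RingHom.mem_ker, Polynomial.hom_eval₂] at this
    rw [← this]
    congr 1
    · ext a <;> simp
    · simp
  obtain ⟨D', hD', hval⟩ := hcen.exists_omegaSet hω hψ hzalg
  refine ⟨D', isStarting_of_evalOne_initialPart fun f hf => hD' f (hker hf), fun i hi => ?_⟩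
  obtain ⟨hzi, n, hn, γ, hγ, hη⟩ := hval i hi
  -- In a row with `η_i = ∞` both `φ(y_i)` and `c_i` are zero, so `z_i = 0` and `η'_i` would be
  -- infinite too.
  have hne : D.η i ≠ ⊤ := by
    intro htop
    refine hzi ?_
    simp only [hz]
    rw [D.c_eq_zero i htop, hφ _ (Ideal.mem_sup_right (Ideal.subset_span ⟨i, htop, rfl⟩))]
    simp
  have hlt : V.valuation (z i * φ (C (AddMonoidAlgebra.single (-scaledRow D.Γ i) 1))) < 1 := by
    have h1 : z i * φ (C (AddMonoidAlgebra.single (-scaledRow D.Γ i) 1)) =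
        φ (toLaurent K ω (scaledRow D.Γ) (X i -
          C (AddMonoidAlgebra.single 0 (D.c i)))) := by
      rw [map_sub (toLaurent K ω _), ← monomial_zero' (R := AddMonoidAlgebra K (nonnegCone ω)),
        toLaurent_monomial, map_zero, sub_zero, map_sub]
      simp only [hz]
      rw [sub_mul, ← map_mul, ← map_mul, ← map_mul, AddMonoidAlgebra.single_mul_single,
        add_neg_cancel, mul_one]
      simp [toLaurent, mul_comm]
    rw [h1, ← ValuationSubring.mem_nonunits_iff]
    refine hV' _ ?_
    rw [map_sub, ← monomial_zero' (R := AddMonoidAlgebra K (nonnegCone ω)), residue_monomial]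
    simp [residue]
  -- The `n`-th power of `z_i x^{-r_i}` has the value of `x^{γ - n r_i}`, so `ω · γ / n > ω · r_i =
  -- d η_i`.
  have hpos : 0 < dot ω (γ - n • scaledRow D.Γ i) := by
    refine hcen.dot_pos ?_
    have h1 : AddMonoidAlgebra.single (γ - n • scaledRow D.Γ i) (1 : K) =
        AddMonoidAlgebra.single γ 1 * AddMonoidAlgebra.single (-scaledRow D.Γ i) 1 ^ n := by
      rw [AddMonoidAlgebra.single_pow, AddMonoidAlgebra.single_mul_single, smul_neg,
        ← sub_eq_add_neg, one_pow, one_mul]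
    rw [h1, map_mul, map_pow, map_mul, ← hγ, map_pow, ← mul_pow, ← map_mul]
    exact pow_lt_one₀ zero_le hlt hn.ne'
  rw [hη]
  obtain ⟨e, he⟩ := WithTop.ne_top_iff_exists.1 hne
  have h2 := hs.dot_eq i
  rw [← he, WithTop.untopD_coe] at h2
  have hn' : (0 : ℝ) < n := by exact_mod_cast hn
  rw [← he, ← WithTop.coe_mul, WithTop.coe_lt_coe, ← h2, lt_div_iff₀ hn']
  rw [map_sub, map_nsmul, nsmul_eq_mul] at hpos
  linarith

theorem IsStarting.transform_isNAdmissible_and_exists [IsAlgClosed K]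
    (hω : LinearIndependent ℚ ω) {I : Ideal (LaurentPoly K N M)} (hI : IsNAdmissible I)
    {D : OmegaSet K M ω} (hD : IsStarting I D) :
    IsNAdmissible (transform I D) ∧
    ∃ D' : OmegaSet K M ω, IsStarting (transform I D) D' ∧ Exceeds D D' := by
  obtain ⟨h1, h2⟩ := hD.transform_inf_eq_bot_and_exists hω hI.isAlgebraicMod
  exact ⟨(hI.isAlgebraicMod.transform D).isNAdmissible h1, h2⟩

theorem idealSeq_congr (I : Ideal (LaurentPoly K N M)) {S S' : ℕ → OmegaSet K M ω} {k : ℕ}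
    (h : ∀ i < k, S i = S' i) : idealSeq I S k = idealSeq I S' k := by
  induction k with
  | zero => rfl
  | succ k ih =>
    rw [idealSeq, idealSeq, ih fun i hi => h i (hi.trans k.lt_succ_self), h k k.lt_succ_self]

theorem exists_isOmegaSequence_top [IsAlgClosed K] (hω : LinearIndependent ℚ ω)
    {I : Ideal (LaurentPoly K N M)} (hI : IsNAdmissible I) {k : ℕ} {S : ℕ → OmegaSet K M ω}
    (hS : IsOmegaSequence I (k : ℕ∞) S) :
    ∃ S' : ℕ → OmegaSet K M ω, (∀ i ≤ k, S' i = S i) ∧ IsOmegaSequence I ⊤ S' := by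
  classical
  -- Carrying the ideal and its admissibility along with the `ω`-set makes the step an iterable
  -- self-map.
  let Good := {p : Ideal (LaurentPoly K N M) × OmegaSet K M ω //
    IsNAdmissible p.1 ∧ IsStarting p.1 p.2}
  have hstep : ∀ p : Good, ∃ q : Good, q.1.1 = transform p.1.1 p.1.2 ∧ Exceeds p.1.2 q.1.2 := by
    rintro ⟨⟨J, D⟩, hJ, hD⟩
    obtain ⟨h1, D', h2, h3⟩ := hD.transform_isNAdmissible_and_exists hω hJ
    exact ⟨⟨⟨_, D'⟩, h1, h2⟩, rfl, h3⟩
  choose next hnext hexc using hstep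
  have hadm : ∀ i ≤ k, IsNAdmissible (idealSeq I S i) := by
    intro i hi
    induction i with
    | zero => exact hI
    | succ i ih =>
      have hi' : i ≤ k := (Nat.le_succ i).trans hi
      exact ((hS.1 i (by exact_mod_cast hi')).transform_isNAdmissible_and_exists hω (ih hi')).1
  let T : ℕ → Good := fun m => next^[m] ⟨⟨idealSeq I S k, S k⟩, hadm k le_rfl, hS.1 k le_rfl⟩
  have hT : ∀ m, T (m + 1) = next (T m) := fun m => Function.iterate_succ_apply' _ _ _
  let S' : ℕ → OmegaSet K M ω := fun i => if i ≤ k then S i else (T (i - k)).1.2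
  have hle : ∀ i ≤ k, S' i = S i := fun i hi => if_pos hi
  have hadd : ∀ m, S' (k + m) = (T m).1.2 := by
    intro m
    rcases m with _ | m
    · exact hle k le_rfl
    · have : ¬ k + (m + 1) ≤ k := by omega
      simp only [S', if_neg this, Nat.add_sub_cancel_left]
  have hseq : ∀ i ≤ k, idealSeq I S' i = idealSeq I S i := fun i hi =>
    idealSeq_congr I fun j hj => hle j (hj.le.trans hi)
  have hseq' : ∀ m, idealSeq I S' (k + m) = (T m).1.1 := by
    intro m
    induction m with
    | zero => exact hseq k le_rfl
    | succ m ih => rw [← add_assoc, idealSeq, ih, hadd, hT, hnext]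
  refine ⟨S', hle, fun i _ => ?_, fun i _ => ?_⟩
  · rcases le_total i k with hi | hi
    · rw [hseq i hi, hle i hi]
      exact hS.1 i (by exact_mod_cast hi)
    · obtain ⟨m, rfl⟩ := Nat.exists_eq_add_of_le hi
      rw [hseq', hadd]
      exact (T m).2.2
  · rcases lt_or_ge i k with hi | hi
    · rw [hle i hi.le, hle (i + 1) hi]
      exact hS.2 i (by exact_mod_cast hi)
    · obtain ⟨m, rfl⟩ := Nat.exists_eq_add_of_le hi
      rw [add_assoc, hadd, hadd, hT]
      exact hexc _

theorem IsOmegaSequence.mono {I : Ideal (LaurentPoly K N M)} {S : ℕ → OmegaSet K M ω} {L L' : ℕ∞}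
    (h : IsOmegaSequence I L S) (hL : L' ≤ L) : IsOmegaSequence I L' S :=
  ⟨fun i hi => h.1 i (hi.trans hL), fun i hi => h.2 i (hi.trans hL)⟩

end Main

end

end NewtonPuiseux

theorem mainTheorem6 {K : Type*} [Field K] [IsAlgClosed K] [CharZero K] {N M : ℕ}
    (ω : Fin N → ℝ) (hω : LinearIndependent ℚ ω)
    (I : Ideal (NewtonPuiseux.LaurentPoly K N M)) (hI : NewtonPuiseux.IsNAdmissible I) :
    (∀ D : NewtonPuiseux.OmegaSet K M ω, NewtonPuiseux.IsStarting I D →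
      NewtonPuiseux.IsNAdmissible (NewtonPuiseux.transform I D) ∧
      ∃ D' : NewtonPuiseux.OmegaSet K M ω,
        NewtonPuiseux.IsStarting (NewtonPuiseux.transform I D) D' ∧
        NewtonPuiseux.Exceeds D D') ∧
    (∀ (k : ℕ) (S : ℕ → NewtonPuiseux.OmegaSet K M ω),
      NewtonPuiseux.IsOmegaSequence I (k : ℕ∞) S →
      ∀ L : ℕ∞, (k : ℕ∞) < L →
        ∃ S' : ℕ → NewtonPuiseux.OmegaSet K M ω,
          (∀ i ≤ k, S' i = S i) ∧ NewtonPuiseux.IsOmegaSequence I L S') := by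
  refine ⟨fun D hD => hD.transform_isNAdmissible_and_exists hω hI, fun k S hS L _ => ?_⟩
  obtain ⟨S', h1, h2⟩ := NewtonPuiseux.exists_isOmegaSequence_top hω hI hS
  exact ⟨S', h1, h2.mono le_top⟩
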